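/- Let $\xi$ be a random variable with values in $\{0,1,2,\dots\}$ such that $\mathbb E\,\xi=1$ and $0<\operatorname{Var}\xi<\infty$. Let $\mathcal T$ be the Galton–Watson tree with offspring distribution $\xi$, i.e. the random rooted family tree in which the numbers of children of the individuals are independent copies of $\xi$. For every $n\ge 1$ with $\mathbb P(|\mathcal T|=n)>0$, let $T_n$ be the conditioned Galton–Watson tree, i.e. $\mathcal T$ conditioned on having exactly $n$ vertices. For a rooted tree $\tau$ and $k\ge 1$, let $P_k(\tau)$ be the number of unordered pairs $\{v,w\}$ of vertices of $\tau$ whose graph distance is $d(v,w)=k$. Then there is a constant $C>0$, depending only on the distribution of $\xi$, such that $$\mathbb E\,P_k(T_n)\le C\,n\,k$$ for all $k\ge 1$ and all $n\ge 1$ such that $T_n$ exists (that is, $\mathbb P(|\mathcal T|=n)>0$). -/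

import Mathlib

open MeasureTheory ProbabilityTheory
open scoped ENNReal NNReal

namespace GW

/-- The sample space of a Galton--Watson process: every individual, encoded by its Ulam--Harris
word `u` (the empty word is the ancestor, and `u ++ [i]` is the child number `i = 0, 1, 2, …` of
`u`), is given a number `ω u` of children. -/
abbrev Sample : Type := List ℕ → ℕ

/-- The law of the Galton--Watson process with offspring distribution `μ`: the numbers of children
are independent, each with distribution `μ`. -/
noncomputable def law (μ : Measure ℕ) [IsProbabilityMeasure μ] : Measure Sample :=
  Measure.infinitePi (fun _ : List ℕ => μ)

/-- The vertex set of the family tree: the words `u` such that, at each step `w → w ++ [i]`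
on the way from the root to `u`, the vertex `w` has a child number `i`. -/
def familyTree (ω : Sample) : Set (List ℕ) :=
  {u | ∀ (w : List ℕ) (i : ℕ), (w ++ [i]) <+: u → i < ω w}

/-- The graph of a tree given by its set of Ulam--Harris words: the edges join
parents and children. -/
def treeGraph (T : Set (List ℕ)) : SimpleGraph T :=
  SimpleGraph.fromRel (fun v w : T => ∃ i : ℕ, (w : List ℕ) = (v : List ℕ) ++ [i])

/-- The number of unordered pairs of vertices `{v, w}` of the tree `T` at graph distance `k`
(used for `k ≥ 1`). -/
noncomputable def pairsAtDist (k : ℕ) (T : Set (List ℕ)) : ℕ∞ :=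
  {e : Sym2 T | ∃ v w : T, e = s(v, w) ∧ (treeGraph T).dist v w = k}.encard

/-- The event that the family tree has exactly `n` vertices. -/
def sizeEvent (n : ℕ) : Set Sample := {ω | (familyTree ω).encard = n}

/-- The law of the Galton--Watson process conditioned on its family tree having `n` vertices; under
this measure `familyTree` is the conditioned Galton--Watson tree with `n` vertices. -/
noncomputable def condLaw (μ : Measure ℕ) [IsProbabilityMeasure μ] (n : ℕ) : Measure Sample :=
  ProbabilityTheory.cond (law μ) (sizeEvent n)

/-- The expected number of unordered pairs of vertices at distance `k` in the conditioned
Galton--Watson tree with `n` vertices, as the expectation of a `[0, ∞]`-valued variable. -/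
noncomputable def expectedPairs (μ : Measure ℕ) [IsProbabilityMeasure μ] (n k : ℕ) : ℝ≥0∞ :=
  ∫⁻ ω, (pairsAtDist k (familyTree ω) : ℝ≥0∞) ∂(condLaw μ n)

end GW

/-! Write 𝚽 for the offspring generating function, 𝐅 = X·𝚽(𝐅) for that of the Galton–Watson tree by
size, 𝐀 = X·𝚽'(𝐅) for a tree with one subtree of the root cut out, and 𝐌 for the series of the
probabilities P(S_m = m), where S_m is a sum of m independent offspring numbers. Let Q be the
generating function of pairs of vertices at distance k. Such a pair contains the root, or has the
root as its branching point, or lies below a single child. Marking a path of j edges costs 𝐀^j, so Q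
= 𝐀^k 𝐅 + (k-1) 𝐀^(k-2) B + 𝐀 Q, where B weights a tree by the number of pairs of children of its
root (`gf_one_pairs`).

Formally 𝐌 = 1/(1-𝐀). Coefficients lie in `ℝ≥0∞`, which has no true subtraction, so this is stated
as 𝐌 = 1 + 𝐀𝐌 (`diagGF_eq`), and U = R + 𝐀U is solved by U = R𝐌 (`eq_mul_diagGF`). The equation for
𝐌 also shows that a factor 𝐀^j in front of R𝐌 can only lower coefficients
(`coeff_spineGF_pow_mul_le`): this is why the bound is linear in k. The cycle lemma, [x^m] 𝐅^d 𝐌 =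
P(S_m = m-d) (`coeff_treeGF_pow_mul_diagGF`), then turns everything into random walk probabilities:
the weighted number of pairs in trees of size n+1 is at most P(S_{n+1} = n) + (k-1) ∑ p_e C(e,2)
P(S_n = n-e), whereas P(S_{n+1} = n) = (n+1) P(|𝒯| = n+1).

It remains to bound P(S_n = n-e) by a constant times P(S_{n+1} = n), uniformly in e
(`exists_coeff_le`). By Fourier inversion over one period of the lattice carrying the offspring law,
the former is O(n^(-1/2)) and the latter, when n is in the lattice, is eventually at least a
multiple of n^(-1/2). The sum of p_e C(e,2) is finite because the variance is. -/

namespace GW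

/-! ### Generating functions of plane forests -/

section GeneratingFunctions

open PowerSeries

/-- The power series `∑ i, w i * X ^ s i` of a weighted family graded by `s`. -/
noncomputable def series {ι : Type*} (w : ι → ℝ≥0∞) (s : ι → ℕ) : ℝ≥0∞⟦X⟧ :=
  PowerSeries.mk fun m => ∑' i, if s i = m then w i else 0

/-- The weighted sum `∑ e, c e * G e` of a sequence of power series. -/
noncomputable def wsum (c : ℕ → ℝ≥0∞) (G : ℕ → ℝ≥0∞⟦X⟧) : ℝ≥0∞⟦X⟧ :=
  PowerSeries.mk fun n => ∑' e, c e * coeff n (G e)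

lemma coeff_wsum (c : ℕ → ℝ≥0∞) (G : ℕ → ℝ≥0∞⟦X⟧) (n : ℕ) :
    coeff n (wsum c G) = ∑' e, c e * coeff n (G e) := coeff_mk _ _

lemma wsum_add (c : ℕ → ℝ≥0∞) (G H : ℕ → ℝ≥0∞⟦X⟧) :
    wsum c (fun e => G e + H e) = wsum c G + wsum c H := by
  ext n
  simp [coeff_wsum, mul_add, ENNReal.tsum_add]

lemma tsum_finsetSum_ennreal {ι κ : Type*} (s : Finset ι) (f : ι → κ → ℝ≥0∞) :
    ∑' k, ∑ i ∈ s, f i k = ∑ i ∈ s, ∑' k, f i k :=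
  Summable.tsum_finsetSum fun _ _ => ENNReal.summable

lemma wsum_mul_right (c : ℕ → ℝ≥0∞) (G : ℕ → ℝ≥0∞⟦X⟧) (H : ℝ≥0∞⟦X⟧) :
    wsum c (fun e => G e * H) = wsum c G * H := by
  ext n
  simp only [coeff_wsum, coeff_mul, Finset.mul_sum, ← ENNReal.tsum_mul_right]
  rw [← tsum_finsetSum_ennreal]
  simp only [mul_assoc]

lemma series_prod {ι κ : Type*} (w : ι → ℝ≥0∞) (s : ι → ℕ) (w' : κ → ℝ≥0∞) (s' : κ → ℕ) :
    series (fun x : ι × κ => w x.1 * w' x.2) (fun x => s x.1 + s' x.2) =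
      series w s * series w' s' := by
  ext n
  simp only [series, coeff_mul, coeff_mk]
  simp only [← ENNReal.tsum_mul_right, ← ENNReal.tsum_mul_left]
  rw [← tsum_finsetSum_ennreal, ENNReal.tsum_prod', ENNReal.tsum_comm]
  refine tsum_congr fun j => ?_
  rw [← tsum_finsetSum_ennreal]
  refine tsum_congr fun i => ?_
  simp only [← ite_and, ite_mul, mul_ite, zero_mul, mul_zero]
  by_cases h : s i + s' j = n
  · rw [if_pos h, Finset.sum_eq_single (s i, s' j)]
    · simp
    · rintro ⟨a, b⟩ _ hab
      rw [if_neg]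
      rintro ⟨rfl, rfl⟩
      exact hab rfl
    · simp [h]
  · rw [if_neg h, Finset.sum_eq_zero]
    rintro ⟨a, b⟩ hab
    rw [if_neg]
    rintro ⟨rfl, rfl⟩
    exact h (by simpa using hab)

/-- A finite plane forest: `cons c s` has a first tree, whose root carries the forest `c` of
subtrees, followed by the trees of `s`. -/
inductive Forest : Type
  | nil : Forest
  | cons (c s : Forest) : Forest

namespace Forest

/-- The number of trees. -/
def len : Forest → ℕ
  | nil => 0
  | cons _ s => s.len + 1

/-- The number of vertices. -/
def size : Forest → ℕ
  | nil => 0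
  | cons c s => 1 + c.size + s.size

/-- The product over all vertices of the weight of the number of children. -/
noncomputable def wt (p : ℕ → ℝ≥0∞) : Forest → ℝ≥0∞
  | nil => 1
  | cons c s => p c.len * c.wt p * s.wt p

/-- The number of vertices at depth `j`, the roots having depth `0`. -/
def level : ℕ → Forest → ℕ
  | _, nil => 0
  | 0, cons _ s => 1 + s.level 0
  | j + 1, cons c s => c.level j + s.level (j + 1)

/-- The number of pairs of vertices at distance `k` once the roots of the forest are joined to a
common ancestor; this ancestor itself is not counted. -/
def pairs (k : ℕ) : Forest → ℕ
  | nil => 0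
  | cons c s => c.level (k - 1) + c.pairs k +
      ∑ i ∈ Finset.range (k - 1), (cons c nil).level i * s.level (k - 2 - i) + s.pairs k

/-- A prefix code for forests. -/
def code : Forest → List Bool
  | nil => [false]
  | cons c s => true :: (code c ++ code s)

/-- The first bit reveals the constructor, so a code can be read off the front of any longer list.
This serves only to make `Forest` countable, as countable additivity requires. -/
lemma code_append_inj (t t' : Forest) (l l' : List Bool) (h : code t ++ l = code t' ++ l') :
    t = t' ∧ l = l' := by
  induction t generalizing t' l l' with
  | nil => cases t' <;> simp_all [code]
  | cons c s ihc ihs =>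
    cases t' with
    | nil => simp [code] at h
    | cons c' s' =>
      simp only [code, List.cons_append, List.append_assoc, List.cons.injEq, true_and] at h
      obtain ⟨rfl, h'⟩ := ihc _ _ _ h
      obtain ⟨rfl, h''⟩ := ihs _ _ _ h'
      exact ⟨rfl, h''⟩

instance : Countable Forest :=
  Function.Injective.countable (f := code) fun t t' h =>
    (code_append_inj t t' [] [] (by simp [h])).1

lemma tsum_eq (f : Forest → ℝ≥0∞) :
    ∑' t, f t = f nil + ∑' x : Forest × Forest, f (cons x.1 x.2) := by
  rw [ENNReal.tsum_eq_add_tsum_ite nil]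
  congr 1
  have hinj : Function.Injective fun x : Forest × Forest => cons x.1 x.2 := by
    rintro ⟨a, b⟩ ⟨a', b'⟩ h
    simpa using h
  rw [← hinj.tsum_eq]
  · exact tsum_congr fun x => if_neg (by simp)
  · rintro (_ | ⟨c, s⟩) h
    · exact absurd (if_pos rfl) h
    · exact ⟨(c, s), rfl⟩

lemma level_cons (j : ℕ) (c s : Forest) :
    (cons c s).level j = (cons c nil).level j + s.level j := by
  cases j <;> simp [level]

lemma len_eq_zero {t : Forest} : t.len = 0 ↔ t = nil := by
  cases t <;> simp [len]

end Forest

open Forest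

variable (p : ℕ → ℝ≥0∞)

/-- The generating function by size of the forests of `d` trees, each weighted by its value
under `f`. -/
noncomputable def gf (d : ℕ) (f : Forest → ℝ≥0∞) : ℝ≥0∞⟦X⟧ :=
  series (fun t => if t.len = d then t.wt p * f t else 0) size

lemma gf_add (d : ℕ) (f g : Forest → ℝ≥0∞) : gf p d (fun t => f t + g t) = gf p d f + gf p d g := by
  ext n
  simp only [gf, series, coeff_mk, map_add, ← ENNReal.tsum_add]
  refine tsum_congr fun t => ?_
  split_ifs <;> simp [mul_add]

lemma gf_sum {ι : Type*} (s : Finset ι) (d : ℕ) (f : ι → Forest → ℝ≥0∞) :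
    gf p d (fun t => ∑ i ∈ s, f i t) = ∑ i ∈ s, gf p d (f i) := by
  classical
  induction s using Finset.induction_on with
  | empty => ext n; simp [gf, series]
  | insert i s hi ih => simp only [Finset.sum_insert hi, gf_add, ih]

lemma gf_zero (f : Forest → ℝ≥0∞) : gf p 0 f = C (f nil) := by
  ext n
  simp only [gf, series, coeff_mk, coeff_C]
  rw [tsum_eq_single nil]
  · simp [size, wt, len, eq_comm]
  · intro t ht
    simp [len_eq_zero, ht]

lemma gf_congr {d : ℕ} {f g : Forest → ℝ≥0∞} (h : ∀ t, t.len = d → f t = g t) :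
    gf p d f = gf p d g := by
  unfold gf
  congr 1
  funext t
  split_ifs with ht
  · rw [h t ht]
  · rfl

lemma X_mul_wsum_gf (g : Forest → ℝ≥0∞) :
    X * wsum p (fun e => gf p e g) =
      series (fun c => p c.len * c.wt p * g c) (fun c => 1 + c.size) := by
  ext n
  rcases n with _ | n
  · simp [series]
  · simp only [coeff_succ_X_mul, coeff_wsum, gf, series, coeff_mk, ← ENNReal.tsum_mul_left]
    rw [ENNReal.tsum_comm]
    refine tsum_congr fun c => ?_
    rw [tsum_eq_single c.len]
    · simp [add_comm 1, mul_assoc]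
    · intro e he
      simp [he.symm]

/-- Peeling off the first tree: its root gives X, its e children give the weight p e and a forest of
e trees, and the remaining d trees form an independent factor. -/
lemma gf_succ (d : ℕ) {f g h : Forest → ℝ≥0∞} (hf : ∀ c s, f (cons c s) = g c * h s) :
    gf p (d + 1) f = X * wsum p (fun e => gf p e g) * gf p d h := by
  rw [X_mul_wsum_gf, gf, gf, ← series_prod]
  ext n
  simp only [series, coeff_mk]
  rw [Forest.tsum_eq]
  rw [if_neg (by simp [len] : ¬ nil.len = d + 1), ite_self, zero_add]
  simp only [len, size, wt, hf]
  refine tsum_congr fun x => ?_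
  simp only [Nat.add_right_cancel_iff, mul_ite, mul_zero]
  refine if_congr Iff.rfl (if_congr Iff.rfl ?_ rfl) rfl
  ring

/-- The generating function of the weighted plane trees. -/
noncomputable def treeGF : ℝ≥0∞⟦X⟧ := gf p 1 1

local notation "𝐅" => treeGF p

lemma gf_one_tree (g : Forest → ℝ≥0∞) (f : Forest → ℝ≥0∞) (hf : ∀ c, f (cons c nil) = g c) :
    gf p 1 f = X * wsum p (fun e => gf p e g) := by
  have h := gf_succ p 0 (f := fun t => match t with | nil => 0 | cons c _ => g c) (g := g)
    (h := fun _ => 1) (fun _ _ => by simp)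
  rw [gf_zero, map_one, mul_one, zero_add] at h
  rw [← h]
  refine gf_congr p fun t ht => ?_
  rcases t with _ | ⟨c, s⟩
  · simp [len] at ht
  · obtain rfl : s = nil := len_eq_zero.1 (by simpa [len] using ht)
    exact hf c

lemma gf_const_one (d : ℕ) : gf p d 1 = 𝐅 ^ d := by
  induction d with
  | zero => simp [gf_zero]
  | succ d ih =>
    rw [gf_succ p d (g := 1) (h := 1) (by simp), ih, ← gf_one_tree p 1 1 (by simp), pow_succ',
      treeGF]

lemma treeGF_eq : 𝐅 = X * wsum p (fun e => 𝐅 ^ e) := by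
  conv_lhs => rw [treeGF, gf_one_tree p 1 1 (by simp)]
  simp only [gf_const_one]

/-- The generating function of the weighted plane trees with a deleted subtree of the root. -/
noncomputable def spineGF : ℝ≥0∞⟦X⟧ := X * wsum p (fun e => (e : ℝ≥0∞⟦X⟧) * 𝐅 ^ (e - 1))

local notation "𝐀" => spineGF p

lemma natCast_mul_pow_pred (e : ℕ) (f : ℝ≥0∞⟦X⟧) :
    (e : ℝ≥0∞⟦X⟧) * f ^ (e - 1) * f = e * f ^ e := by
  cases e with
  | zero => simp
  | succ e => rw [Nat.add_sub_cancel, pow_succ, mul_assoc]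

lemma X_mul_wsum_natCast (G : ℝ≥0∞⟦X⟧) :
    X * wsum p (fun e => (e : ℝ≥0∞⟦X⟧) * 𝐅 ^ (e - 1) * G) = 𝐀 * G := by
  rw [wsum_mul_right, spineGF, mul_assoc]

/-- An additive functional of forests. -/
lemma gf_of_additive {f : Forest → ℝ≥0∞} (h0 : f nil = 0)
    (hf : ∀ c s, f (cons c s) = f (cons c nil) + f s) (d : ℕ) :
    gf p d f = (d : ℝ≥0∞⟦X⟧) * 𝐅 ^ (d - 1) * gf p 1 f := by
  induction d with
  | zero => simp [gf_zero, h0]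
  | succ d ih =>
    -- Split f into the share of the first tree and that of the rest; each share is a product to
    -- which `gf_succ` applies.
    have h1 : gf p (d + 1) f =
        gf p (d + 1) (fun t => match t with | nil => 0 | cons c _ => f (cons c nil)) +
        gf p (d + 1) (fun t => match t with | nil => 0 | cons _ s => f s) := by
      rw [← gf_add]
      refine gf_congr p fun t ht => ?_
      rcases t with _ | ⟨c, s⟩
      · simp [h0]
      · exact hf c s
    rw [h1, gf_succ p d (g := fun c => f (cons c nil)) (h := 1) (by simp),
      gf_succ p d (g := 1) (h := f) (by simp), ← gf_one_tree p _ f (fun _ => rfl),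
      ← gf_one_tree p 1 1 (by simp), ih, gf_const_one, Nat.add_sub_cancel, ← treeGF]
    push_cast
    calc _ = gf p 1 f * (d * 𝐅 ^ (d - 1) * 𝐅 + 𝐅 ^ d) := by ring
      _ = _ := by rw [natCast_mul_pow_pred]; ring

lemma wsum_gf_of_additive {f : Forest → ℝ≥0∞} (h0 : f nil = 0)
    (hf : ∀ c s, f (cons c s) = f (cons c nil) + f s) :
    X * wsum p (fun e => gf p e f) = 𝐀 * gf p 1 f := by
  rw [funext (gf_of_additive p h0 hf)]
  exact X_mul_wsum_natCast p _

/-- A vertex at depth j marks a path from the root: each of its j steps contributes a vertex with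
one child singled out and the other subtrees left in place, hence 𝐀, and the subtree at its end
gives 𝐅. -/
lemma gf_one_level (j : ℕ) : gf p 1 (fun t => t.level j) = 𝐀 ^ j * 𝐅 := by
  induction j with
  | zero =>
    rw [pow_zero, one_mul, treeGF, gf_one_tree p 1 _ (by simp [level]), gf_one_tree p 1 1 (by simp)]
  | succ j ih =>
    rw [gf_one_tree p (fun t => t.level j) _ (by simp [level]),
      wsum_gf_of_additive p (by simp [level]) (fun c s => by rw [level_cons]; push_cast; rfl), ih,
      pow_succ', mul_assoc]

lemma gf_level (j d : ℕ) : gf p d (fun t => t.level j) = (d : ℝ≥0∞⟦X⟧) * 𝐀 ^ j * 𝐅 ^ d := by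
  rw [gf_of_additive p (by simp [level]) (fun c s => by rw [level_cons]; push_cast; rfl),
    gf_one_level]
  calc _ = (d * 𝐅 ^ (d - 1) * 𝐅) * 𝐀 ^ j := by ring
    _ = _ := by rw [natCast_mul_pow_pred]; ring

/-- A marked vertex is the root or lies below one of its children. -/
lemma gf_one_size : gf p 1 (fun t => t.size) = 𝐅 + 𝐀 * gf p 1 (fun t => t.size) := by
  conv_lhs => rw [gf_one_tree p (fun t => (1 : Forest → ℝ≥0∞) t + t.size) _ (by simp [size])]
  simp only [gf_add, gf_const_one, wsum_add, mul_add]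
  rw [← treeGF_eq, wsum_gf_of_additive p (by simp [size]) (fun c s => by simp [size])]

lemma coeff_gf_size (d n : ℕ) :
    coeff n (gf p d (fun t => t.size)) = n * coeff n (gf p d 1) := by
  simp only [gf, series, coeff_mk, ← ENNReal.tsum_mul_left]
  refine tsum_congr fun t => ?_
  split_ifs with h1 h2 <;> simp
  rw [h1, mul_comm]

/-- The generating function of the plane trees weighted by the number of pairs of children of the
root. -/
noncomputable def rootPairsGF : ℝ≥0∞⟦X⟧ :=
  X * wsum p (fun e => (e.choose 2 : ℝ≥0∞⟦X⟧) * 𝐅 ^ e)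

/-- A pair lies in one tree, the others giving 𝐅 ^ (d - 1), or in two of the d trees at depths i and
k - 2 - i. In the latter case the paths give 𝐀 ^ (k - 2) for each of the k - 1 values of i. -/
lemma gf_pairs (k d : ℕ) : gf p d (fun t => t.pairs k) =
    (d : ℝ≥0∞⟦X⟧) * 𝐅 ^ (d - 1) * gf p 1 (fun t => t.pairs k) +
      (k - 1 : ℕ) * 𝐀 ^ (k - 2) * ((d.choose 2 : ℝ≥0∞⟦X⟧) * 𝐅 ^ d) := by
  induction d with
  | zero => simp [gf_zero, pairs]
  | succ d ih =>
    have h1 : gf p (d + 1) (fun t => t.pairs k) =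
        gf p (d + 1) (fun t => match t with
          | nil => 0
          | cons c _ => ((cons c nil).pairs k : ℝ≥0∞)) +
        gf p (d + 1) (fun t => ∑ i ∈ Finset.range (k - 1), match t with
          | nil => 0
          | cons c s => ((cons c nil).level i * s.level (k - 2 - i) : ℝ≥0∞)) +
        gf p (d + 1) (fun t => match t with | nil => 0 | cons _ s => (s.pairs k : ℝ≥0∞)) := by
      rw [← gf_add, ← gf_add]
      refine gf_congr p fun t ht => ?_
      rcases t with _ | ⟨c, s⟩
      · simp [pairs]
      · simp [pairs, level]
    have h2 : ∀ i ∈ Finset.range (k - 1), gf p (d + 1) (fun t => match t with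
          | nil => 0
          | cons c s => ((cons c nil).level i * s.level (k - 2 - i) : ℝ≥0∞)) =
        𝐀 ^ (k - 2) * (d * 𝐅 ^ (d + 1)) := by
      intro i hi
      rw [gf_succ p d (g := fun c => (cons c nil).level i) (h := fun s => s.level (k - 2 - i))
        (by simp), gf_level, ← gf_one_tree p _ (fun t => t.level i) (fun _ => rfl), gf_level]
      have : 𝐀 ^ (k - 2) = 𝐀 ^ i * 𝐀 ^ (k - 2 - i) := by
        rw [← pow_add]
        congr 1
        have := Finset.mem_range.1 hi
        omega
      rw [this]
      push_cast
      ring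
    rw [h1, gf_succ p d (g := fun c => (cons c nil).pairs k) (h := 1) (by simp), gf_sum,
      Finset.sum_congr rfl h2, gf_succ p d (g := 1) (h := fun s => s.pairs k) (by simp),
      ← gf_one_tree p _ (fun t => t.pairs k) (fun _ => rfl),
      ← gf_one_tree p 1 1 (by simp), ih, gf_const_one, Nat.add_sub_cancel, ← treeGF,
      Finset.sum_const, Finset.card_range, nsmul_eq_mul, Nat.choose_succ_succ' d 1,
      Nat.choose_one_right]
    push_cast
    calc _ = gf p 1 (fun t => t.pairs k) * (d * 𝐅 ^ (d - 1) * 𝐅 + 𝐅 ^ d) +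
          (k - 1 : ℕ) * 𝐀 ^ (k - 2) * ((d + d.choose 2 : ℝ≥0∞⟦X⟧) * 𝐅 ^ (d + 1)) := by ring
      _ = _ := by rw [natCast_mul_pow_pred]; ring

/-- The terms count the pairs containing the root, those branching at the root, and those below one
child. For k = 1 the factor k - 1 vanishes, so the truncated exponent k - 2 is harmless. -/
lemma gf_one_pairs {k : ℕ} (hk : 1 ≤ k) : gf p 1 (fun t => t.pairs k) =
    𝐀 ^ k * 𝐅 + (k - 1 : ℕ) * 𝐀 ^ (k - 2) * rootPairsGF p +
      𝐀 * gf p 1 (fun t => t.pairs k) := by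
  conv_lhs =>
    rw [gf_one_tree p (fun t => (t.level (k - 1) : ℝ≥0∞) + t.pairs k) _ (by simp [pairs, level])]
  simp only [gf_add, wsum_add, mul_add]
  rw [wsum_gf_of_additive p (by simp [level]) (fun c s => by rw [level_cons]; push_cast; rfl),
    gf_one_level]
  rw [funext (gf_pairs p k), wsum_add, mul_add, X_mul_wsum_natCast]
  obtain ⟨k, rfl⟩ : ∃ j, k = j + 1 := ⟨k - 1, by omega⟩
  have : X * wsum p (fun e => ((k + 1 - 1 : ℕ) : ℝ≥0∞⟦X⟧) * 𝐀 ^ (k + 1 - 2) *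
      ((e.choose 2 : ℝ≥0∞⟦X⟧) * 𝐅 ^ e)) =
      ((k + 1 - 1 : ℕ) : ℝ≥0∞⟦X⟧) * 𝐀 ^ (k + 1 - 2) * rootPairsGF p := by
    simp only [mul_comm (((k + 1 - 1 : ℕ) : ℝ≥0∞⟦X⟧) * 𝐀 ^ (k + 1 - 2)) _]
    rw [wsum_mul_right, rootPairsGF, mul_assoc]
  rw [this, Nat.add_sub_cancel, pow_succ' 𝐀 k]
  ring

/-- The generating function of the weights. -/
noncomputable def weightGF : ℝ≥0∞⟦X⟧ := PowerSeries.mk p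

local notation "𝚽" => weightGF p

/-- The generating function of the probabilities that the sum of `m` independent variables
with distribution `p` equals `m`. -/
noncomputable def diagGF : ℝ≥0∞⟦X⟧ := PowerSeries.mk fun m => coeff m (𝚽 ^ m)

local notation "𝐌" => diagGF p

lemma weightGF_mul (G : ℝ≥0∞⟦X⟧) : 𝚽 * G = wsum p (fun e => X ^ e * G) := by
  ext n
  rw [coeff_wsum, coeff_mul, Finset.Nat.sum_antidiagonal_eq_sum_range_succ_mk,
    tsum_eq_sum (s := Finset.range (n + 1))]
  · refine Finset.sum_congr rfl fun e he => ?_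
    rw [coeff_X_pow_mul', if_pos (by simpa [Nat.lt_succ_iff] using he), weightGF, coeff_mk]
  · intro e he
    rw [coeff_X_pow_mul', if_neg (by simpa [Nat.lt_succ_iff] using he), mul_zero]

lemma coeff_natCast_mul (e n : ℕ) (G : ℝ≥0∞⟦X⟧) :
    coeff n ((e : ℝ≥0∞⟦X⟧) * G) = e * coeff n G := by
  rw [← nsmul_eq_mul, map_nsmul, nsmul_eq_mul]

/-- Compare coefficients in the derivative of 𝚽 ^ (m + 1) and cancel m + 1, which is nonzero and
finite. -/
lemma coeff_succ_weightGF_pow_succ (m : ℕ) : coeff (m + 1) (𝚽 ^ (m + 1)) =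
    coeff m (wsum p (fun e => (e : ℝ≥0∞⟦X⟧) * X ^ (e - 1) * 𝚽 ^ m)) := by
  have hd : d⁄dX ℝ≥0∞ 𝚽 = wsum p (fun e => (e : ℝ≥0∞⟦X⟧) * X ^ (e - 1)) := by
    ext n
    rw [coeff_derivative, coeff_wsum, tsum_eq_single (n + 1)]
    · rw [coeff_natCast_mul, Nat.add_sub_cancel, coeff_X_pow_self, weightGF, coeff_mk]
      push_cast
      ring
    · rintro (_ | e) he
      · simp
      · rw [coeff_natCast_mul, Nat.add_sub_cancel, coeff_X_pow, if_neg (by omega), mul_zero,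
          mul_zero]
  have h := congrArg (coeff m) (derivative_pow (R := ℝ≥0∞) 𝚽 (m + 1))
  rw [coeff_derivative, Nat.add_sub_cancel, hd, mul_assoc, ← nsmul_eq_mul, map_nsmul, nsmul_eq_mul,
    mul_comm (𝚽 ^ m), ← wsum_mul_right, mul_comm] at h
  have h0 : ((m + 1 : ℕ) : ℝ≥0∞) ≠ 0 := by simp
  have h1 : ((m + 1 : ℕ) : ℝ≥0∞) ≠ ⊤ := ENNReal.natCast_ne_top _
  refine (ENNReal.mul_right_inj h0 h1).1 ?_
  simpa using h

lemma treeGF_pow_succ (d : ℕ) : 𝐅 ^ (d + 1) = X * wsum p (fun e => 𝐅 ^ (e + d)) := by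
  rw [pow_succ']
  nth_rewrite 1 [treeGF_eq p]
  rw [mul_assoc, ← wsum_mul_right]
  simp only [pow_add]

/-- The cycle lemma, as an identity of generating functions. -/
lemma coeff_treeGF_pow_mul_diagGF (d m : ℕ) :
    coeff m (𝐅 ^ d * 𝐌) = coeff m (X ^ d * 𝚽 ^ m) := by
  induction m generalizing d with
  | zero =>
    rcases d with _ | d
    · simp [diagGF]
    · rw [treeGF_pow_succ, mul_assoc, coeff_zero_X_mul, pow_succ', mul_assoc, coeff_zero_X_mul]
  | succ m ih =>
    rcases d with _ | d
    · simp [diagGF]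
    · rw [treeGF_pow_succ, mul_assoc, coeff_succ_X_mul, pow_succ' X, mul_assoc, coeff_succ_X_mul,
        ← wsum_mul_right, coeff_wsum, pow_succ', mul_left_comm, weightGF_mul, coeff_wsum]
      -- Both sides obey the same recursion: the first tree is replaced by its e subtrees, just as
      -- the first walk step is conditioned to be e.
      refine tsum_congr fun e => ?_
      rw [ih, pow_add, mul_assoc]

/-- By differentiation the left coefficient is that of ∑ e p_e X^(e-1) 𝚽^m; the cycle lemma replaces
X^(e-1) 𝚽^m by 𝐅^(e-1) 𝐌, which is what 𝐀𝐌 contains. -/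
lemma diagGF_eq : 𝐌 = 1 + 𝐀 * 𝐌 := by
  ext m
  rw [map_add, spineGF, mul_assoc]
  rcases m with _ | m
  · simp [diagGF]
  · rw [coeff_succ_X_mul, ← wsum_mul_right, diagGF, coeff_mk, coeff_succ_weightGF_pow_succ,
      coeff_one, if_neg m.succ_ne_zero, zero_add, coeff_wsum, coeff_wsum]
    refine tsum_congr fun e => ?_
    rw [← diagGF, mul_assoc, mul_assoc, ← nsmul_eq_mul, ← nsmul_eq_mul, map_nsmul, map_nsmul,
      coeff_treeGF_pow_mul_diagGF]

/-- 𝐀 has a factor X, so the equation determines each coefficient from the earlier ones, and R * 𝐌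
solves it too. -/
lemma eq_mul_diagGF {U R : ℝ≥0∞⟦X⟧} (h : U = R + 𝐀 * U) : U = R * 𝐌 := by
  have h' : R * 𝐌 = R + 𝐀 * (R * 𝐌) := by
    conv_lhs => rw [diagGF_eq]
    ring
  ext n
  induction n using Nat.strong_induction_on with
  | _ n ih =>
    rw [h, h', map_add, map_add, spineGF, mul_assoc, mul_assoc]
    rcases n with _ | n
    · simp
    · rw [coeff_succ_X_mul, coeff_succ_X_mul, coeff_mul, coeff_mul]
      congr 1
      refine Finset.sum_congr rfl fun x hx => ?_
      rw [ih _ (Nat.lt_succ_of_le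
        (Finset.HasAntidiagonal.mem_antidiagonal.1 hx ▸ Nat.le_add_left _ _))]

/-- Since 𝐌 = 1 + 𝐀𝐌 has nonnegative terms, each further factor 𝐀 only drops a summand. -/
lemma coeff_spineGF_pow_mul_le (R : ℝ≥0∞⟦X⟧) (j n : ℕ) :
    coeff n (𝐀 ^ j * (R * 𝐌)) ≤ coeff n (R * 𝐌) := by
  induction j with
  | zero => simp
  | succ j ih =>
    refine le_trans ?_ ih
    conv_rhs => rw [diagGF_eq]
    have : 𝐀 ^ j * (R * (1 + 𝐀 * 𝐌)) = 𝐀 ^ j * R + 𝐀 ^ (j + 1) * (R * 𝐌) := by ring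
    rw [this, map_add]
    exact le_add_self

/-- The weight of the trees with `n + 1` vertices. -/
lemma succ_mul_coeff_treeGF (n : ℕ) :
    (n + 1 : ℕ) * coeff (n + 1) 𝐅 = coeff n (𝚽 ^ (n + 1)) := by
  rw [treeGF, ← coeff_gf_size, eq_mul_diagGF p (gf_one_size p), ← pow_one 𝐅,
    coeff_treeGF_pow_mul_diagGF, pow_one, coeff_succ_X_mul]

lemma coeff_rootPairsGF_mul_diagGF (n : ℕ) : coeff (n + 1) (rootPairsGF p * 𝐌) =
    ∑' e, p e * (e.choose 2 * coeff n (X ^ e * 𝚽 ^ n)) := by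
  rw [rootPairsGF, mul_assoc, coeff_succ_X_mul, ← wsum_mul_right, coeff_wsum]
  refine tsum_congr fun e => ?_
  rw [mul_assoc, ← nsmul_eq_mul, map_nsmul, coeff_treeGF_pow_mul_diagGF, nsmul_eq_mul]

/-- The weighted number of pairs of vertices at distance `k` in the trees with `n + 1` vertices. -/
lemma coeff_gf_pairs_le {k : ℕ} (hk : 1 ≤ k) (n : ℕ) :
    coeff (n + 1) (gf p 1 (fun t => t.pairs k)) ≤ coeff n (𝚽 ^ (n + 1)) +
      (k - 1 : ℕ) * ∑' e, p e * (e.choose 2 * coeff n (X ^ e * 𝚽 ^ n)) := by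
  rw [eq_mul_diagGF p (gf_one_pairs p hk), add_mul, map_add, ← coeff_rootPairsGF_mul_diagGF]
  refine add_le_add ?_ ?_
  · rw [mul_assoc]
    refine (coeff_spineGF_pow_mul_le p _ _ _).trans_eq ?_
    rw [← pow_one 𝐅, coeff_treeGF_pow_mul_diagGF, pow_one, coeff_succ_X_mul]
  · rw [mul_assoc, mul_assoc, ← nsmul_eq_mul, map_nsmul, nsmul_eq_mul]
    gcongr
    exact coeff_spineGF_pow_mul_le p _ _ _

end GeneratingFunctions

/-! ### Forests and family trees -/

section Representation

open Forest

/-- The subtrees of the root of the family tree are those of `c`, the tree number `i` of `c`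
from the end being the subtree of the child number `i`. -/
def Represents : Forest → Sample → Prop
  | nil, _ => True
  | cons c s, ω => ω [s.len] = c.len ∧ Represents c (fun u => ω (s.len :: u)) ∧ Represents s ω

/-- The vertices of a forest below a common root, which is excluded. -/
def verts : Forest → Finset (List ℕ)
  | nil => ∅
  | cons c s => (insert [] (verts c)).image (s.len :: ·) ∪ verts s

/-- The numbers of children of the vertices of a forest. -/
def childCount : Forest → List ℕ → ℕ
  | nil, _ => 0
  | cons _ _, [] => 0
  | cons c s, i :: u =>
    if i = s.len then (if u = [] then c.len else childCount c u) else childCount s (i :: u)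

lemma exists_of_mem_verts {t : Forest} {u : List ℕ} (hu : u ∈ verts t) :
    ∃ i v, u = i :: v ∧ i < t.len := by
  induction t with
  | nil => simp [verts] at hu
  | cons c s _ ih =>
    simp only [verts, Finset.mem_union, Finset.mem_image] at hu
    rcases hu with ⟨v, _, rfl⟩ | hu
    · exact ⟨_, v, rfl, by simp [len]⟩
    · obtain ⟨i, v, rfl, hi⟩ := ih hu
      exact ⟨i, v, rfl, by simp only [len]; omega⟩

lemma nil_notMem_verts (t : Forest) : [] ∉ verts t := fun h => by
  obtain ⟨i, v, h, _⟩ := exists_of_mem_verts h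
  simp at h

lemma disjoint_verts (c s : Forest) :
    Disjoint ((insert [] (verts c)).image (s.len :: ·)) (verts s) := by
  rw [Finset.disjoint_left]
  intro u hu hs
  obtain ⟨v, _, rfl⟩ := Finset.mem_image.1 hu
  obtain ⟨i, w, h, hi⟩ := exists_of_mem_verts hs
  simp only [List.cons.injEq] at h
  omega

lemma card_insert_nil_verts (t : Forest) : (insert [] (verts t)).card = (verts t).card + 1 :=
  Finset.card_insert_of_notMem (nil_notMem_verts t)

lemma card_verts (t : Forest) : (verts t).card = t.size := by
  induction t with
  | nil => rfl
  | cons c s hc hs =>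
    rw [verts, Finset.card_union_of_disjoint (disjoint_verts c s),
      Finset.card_image_of_injective _ List.cons_injective, card_insert_nil_verts, hc, hs, size]
    omega

lemma represents_iff (t : Forest) (ω : Sample) :
    Represents t ω ↔ ∀ u ∈ verts t, ω u = childCount t u := by
  induction t generalizing ω with
  | nil => simp [Represents, verts]
  | cons c s hc hs =>
    simp only [Represents, hc, hs, verts, Finset.mem_union, Finset.mem_image, Finset.mem_insert]
    constructor
    · rintro ⟨h1, h2, h3⟩ u (⟨v, rfl | hv, rfl⟩ | hu)
      · simpa [childCount] using h1
      · have : v ≠ [] := fun h => nil_notMem_verts c (h ▸ hv)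
        simpa [childCount, this] using h2 v hv
      · obtain ⟨i, v, rfl, hi⟩ := exists_of_mem_verts hu
        rw [h3 _ hu, childCount, if_neg hi.ne]
    · intro h
      refine ⟨?_, fun v hv => ?_, fun u hu => ?_⟩
      · simpa [childCount] using h [s.len] (Or.inl ⟨[], Or.inl rfl, rfl⟩)
      · have : v ≠ [] := fun h => nil_notMem_verts c (h ▸ hv)
        simpa [childCount, this] using h (s.len :: v) (Or.inl ⟨v, Or.inr hv, rfl⟩)
      · obtain ⟨i, v, rfl, hi⟩ := exists_of_mem_verts hu
        rw [h _ (Or.inr hu), childCount, if_neg hi.ne]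

lemma prod_verts (p : ℕ → ℝ≥0∞) (t : Forest) :
    ∏ u ∈ verts t, p (childCount t u) = t.wt p := by
  induction t with
  | nil => simp [verts, wt]
  | cons c s hc hs =>
    rw [verts, Finset.prod_union (disjoint_verts c s),
      Finset.prod_image (List.cons_injective.injOn), Finset.prod_insert (nil_notMem_verts c), wt,
      ← hc, ← hs]
    congr 1
    · congr 1
      · simp [childCount]
      · refine Finset.prod_congr rfl fun v hv => ?_
        have : v ≠ [] := fun h => nil_notMem_verts c (h ▸ hv)
        simp [childCount, this]
    · refine Finset.prod_congr rfl fun u hu => ?_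
      obtain ⟨i, v, rfl, hi⟩ := exists_of_mem_verts hu
      rw [childCount, if_neg hi.ne]

lemma eq_of_represents {t t' : Forest} {ω : Sample} (h : Represents t ω) (h' : Represents t' ω)
    (hl : t.len = t'.len) : t = t' := by
  induction t generalizing t' ω with
  | nil => cases t' <;> simp_all [len]
  | cons c s hc hs =>
    cases t' with
    | nil => simp [len] at hl
    | cons c' s' =>
      simp only [len, Nat.add_right_cancel_iff] at hl
      obtain ⟨h1, h2, h3⟩ := h
      obtain ⟨h1', h2', h3'⟩ := h'
      rw [← hl] at h1' h2'
      rw [hc h2 h2' (h1.symm.trans h1'), hs h3 h3' hl]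

/-- The family tree is the tree whose root carries the forest `t`. -/
def TreeRepresents (t : Forest) (ω : Sample) : Prop := ω [] = t.len ∧ Represents t ω

lemma eq_of_treeRepresents {t t' : Forest} {ω : Sample} (h : TreeRepresents t ω)
    (h' : TreeRepresents t' ω) : t = t' :=
  eq_of_represents h.2 h'.2 (h.1.symm.trans h'.1)

lemma nil_mem_familyTree (ω : Sample) : [] ∈ familyTree ω := by
  intro w i h
  simp at h

lemma cons_mem_familyTree {ω : Sample} {i : ℕ} {u : List ℕ} :
    i :: u ∈ familyTree ω ↔ i < ω [] ∧ u ∈ familyTree (fun v => ω (i :: v)) := by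
  constructor
  · intro h
    exact ⟨h [] i (by simp), fun w j hw => h (i :: w) j (by simpa using hw)⟩
  · rintro ⟨h1, h2⟩ w j hw
    rcases w with _ | ⟨a, w⟩
    · obtain rfl : j = i := by simpa using hw
      exact h1
    · obtain ⟨rfl, hw'⟩ : a = i ∧ (w ++ [j]) <+: u := by simpa using hw
      exact h2 w j hw'

lemma familyTree_eq {t : Forest} {ω : Sample} (h : TreeRepresents t ω) :
    familyTree ω = ↑(insert [] (verts t)) := by
  have key : ∀ (t : Forest) (ω : Sample), Represents t ω → ∀ i < t.len, ∀ u,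
      (i :: u ∈ verts t ↔ u ∈ familyTree (fun v => ω (i :: v))) := by
    intro t
    induction t with
    | nil => intro ω _ i hi; simp [len] at hi
    | cons c s hc hs =>
      intro ω h i hi u
      obtain ⟨h1, h2, h3⟩ := h
      simp only [verts, Finset.mem_union, Finset.mem_image, List.cons.injEq]
      rcases eq_or_ne i s.len with rfl | hne
      · have hn : s.len :: u ∉ verts s := fun h => by
          obtain ⟨i, w, h, hi⟩ := exists_of_mem_verts h
          simp only [List.cons.injEq] at h
          omega
        simp only [hn, or_false, true_and, exists_eq_right, Finset.mem_insert]
        rcases u with _ | ⟨j, u⟩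
        · simp [nil_mem_familyTree]
        · rw [cons_mem_familyTree, h1]
          simp only [reduceCtorEq, false_or]
          constructor
          · intro hu
            obtain ⟨j', u', h, hj⟩ := exists_of_mem_verts hu
            simp only [List.cons.injEq] at h
            obtain ⟨rfl, rfl⟩ := h
            exact ⟨hj, (hc _ h2 _ hj _).1 hu⟩
          · rintro ⟨hj, hu⟩
            exact (hc _ h2 _ hj _).2 hu
      · simp only [hne.symm, false_and, and_false, exists_false, false_or]
        exact hs _ h3 i (by simp only [len] at hi; omega) u
  ext u
  rcases u with _ | ⟨i, u⟩
  · simp [nil_mem_familyTree]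
  · rw [cons_mem_familyTree, h.1]
    simp only [Finset.coe_insert, Set.mem_insert_iff, reduceCtorEq, false_or, Finset.mem_coe]
    constructor
    · rintro ⟨hi, hu⟩
      exact (key _ _ h.2 _ hi _).2 hu
    · intro hu
      obtain ⟨j', u', h', hj⟩ := exists_of_mem_verts hu
      simp only [List.cons.injEq] at h'
      obtain ⟨rfl, rfl⟩ := h'
      exact ⟨hj, (key _ _ h.2 _ hj _).1 hu⟩

lemma encard_familyTree {t : Forest} {ω : Sample} (h : TreeRepresents t ω) :
    (familyTree ω).encard = (1 + t.size : ℕ) := by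
  rw [familyTree_eq h, Set.encard_coe_eq_coe_finsetCard, card_insert_nil_verts, card_verts,
    add_comm]

/-- The subtree of a child misses the root, so its cardinality bound drops by one; the subtrees
found by induction are then stacked into a forest. -/
lemma exists_treeRepresents {n : ℕ} {ω : Sample} (h : (familyTree ω).encard ≤ n) :
    ∃ t, TreeRepresents t ω := by
  induction n generalizing ω with
  | zero =>
    have : familyTree ω = ∅ := by simpa using h
    exact absurd (nil_mem_familyTree ω) (by simp [this])
  | succ n ih =>
    have hsub : ∀ i < ω [], ∃ t, TreeRepresents t (fun v => ω (i :: v)) := by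
      intro i hi
      refine ih ?_
      have h1 : insert [] ((i :: ·) '' familyTree (fun v => ω (i :: v))) ⊆ familyTree ω := by
        rintro u (rfl | ⟨v, hv, rfl⟩)
        · exact nil_mem_familyTree ω
        · exact cons_mem_familyTree.2 ⟨hi, hv⟩
      have h2 := (Set.encard_le_encard h1).trans h
      rw [Set.encard_insert_of_notMem (by simp), List.cons_injective.encard_image] at h2
      push_cast at h2
      exact (ENat.add_le_add_iff_right (by simp)).1 h2
    have hfor : ∀ m ≤ ω [], ∃ s : Forest, s.len = m ∧ Represents s ω := by
      intro m
      induction m with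
      | zero => exact fun _ => ⟨nil, rfl, trivial⟩
      | succ m ihm =>
        intro hm
        obtain ⟨s, rfl, hs⟩ := ihm (by omega)
        obtain ⟨c, hc1, hc2⟩ := hsub s.len (by omega)
        exact ⟨cons c s, rfl, hc1, hc2, hs⟩
    obtain ⟨s, hs, hr⟩ := hfor _ le_rfl
    exact ⟨s, hs.symm, hr⟩

/-- A cylinder event: only the finitely many offspring numbers at the vertices are prescribed. -/
lemma setOf_treeRepresents (t : Forest) : {ω : Sample | TreeRepresents t ω} =
    Set.pi ↑(insert [] (verts t)) (fun u => {if u = [] then t.len else childCount t u}) := by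
  ext ω
  simp only [TreeRepresents, represents_iff, Set.mem_ofPred_eq, Set.mem_pi, Finset.coe_insert,
    Set.mem_insert_iff, forall_eq_or_imp, if_true, Set.mem_singleton_iff, Finset.mem_coe]
  refine and_congr_right fun _ => forall₂_congr fun u hu => ?_
  rw [if_neg fun h : u = [] => nil_notMem_verts t (h ▸ hu)]

lemma measurableSet_treeRepresents (t : Forest) :
    MeasurableSet {ω : Sample | TreeRepresents t ω} := by
  rw [setOf_treeRepresents]
  exact MeasurableSet.pi (Finset.countable_toSet _) fun _ _ => MeasurableSet.of_discrete

lemma law_treeRepresents (μ : Measure ℕ) [IsProbabilityMeasure μ] (t : Forest) :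
    law μ {ω | TreeRepresents t ω} = μ {t.len} * t.wt (fun d => μ {d}) := by
  rw [setOf_treeRepresents, law,
    Measure.infinitePi_pi (μ := fun _ : List ℕ => μ) (fun _ _ => MeasurableSet.of_discrete),
    Finset.prod_insert (nil_notMem_verts t), if_pos rfl,
    ← prod_verts]
  congr 1
  refine Finset.prod_congr rfl fun u hu => ?_
  rw [if_neg fun h : u = [] => nil_notMem_verts t (h ▸ hu)]

end Representation

/-! ### Distances -/

section Distance

open Forest

/-- The distance of two Ulam--Harris words in the tree of all words. -/
def wordDist : List ℕ → List ℕ → ℕ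
  | [], w => w.length
  | v, [] => v.length
  | a :: v, b :: w => if a = b then wordDist v w else v.length + w.length + 2

lemma wordDist_nil_left (w : List ℕ) : wordDist [] w = w.length := by
  cases w <;> simp [wordDist]

lemma wordDist_nil_right (v : List ℕ) : wordDist v [] = v.length := by
  cases v <;> simp [wordDist]

lemma wordDist_self (v : List ℕ) : wordDist v v = 0 := by
  induction v <;> simp_all [wordDist]

/-- `wordDist` changes by at most one along an edge, so it bounds the length of every walk from
below. -/
lemma wordDist_append_singleton_le (v : List ℕ) (i : ℕ) (w : List ℕ) :
    wordDist (v ++ [i]) w ≤ wordDist v w + 1 ∧ wordDist v w ≤ wordDist (v ++ [i]) w + 1 := by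
  induction v generalizing w with
  | nil =>
    rcases w with _ | ⟨b, w⟩
    · simp [wordDist]
    · simp only [List.nil_append, wordDist, List.length_cons, List.length_nil]
      split_ifs <;> omega
  | cons a v ih =>
    rcases w with _ | ⟨b, w⟩
    · simp [wordDist]
    · simp only [List.cons_append, wordDist, List.length_append, List.length_singleton]
      have := ih w
      split_ifs <;> omega

lemma exists_eq_append (v w : List ℕ) :
    ∃ x y z, v = x ++ y ∧ w = x ++ z ∧ wordDist v w = y.length + z.length := by
  induction v generalizing w with
  | nil => exact ⟨[], [], w, rfl, rfl, by simp [wordDist_nil_left]⟩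
  | cons a v ih =>
    rcases w with _ | ⟨b, w⟩
    · exact ⟨[], a :: v, [], rfl, rfl, by simp [wordDist]⟩
    · by_cases h : a = b
      · obtain ⟨x, y, z, rfl, rfl, hd⟩ := ih w
        exact ⟨a :: x, y, z, rfl, by simp [h], by simp [wordDist, h, hd]⟩
      · exact ⟨[], a :: v, b :: w, rfl, rfl, by simp [wordDist, h]; omega⟩

lemma treeGraph_adj {T : Set (List ℕ)} {v w : T} : (treeGraph T).Adj v w ↔
    (∃ i : ℕ, (w : List ℕ) = v ++ [i]) ∨ ∃ i : ℕ, (v : List ℕ) = w ++ [i] := by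
  rw [treeGraph, SimpleGraph.fromRel_adj]
  refine ⟨fun h => h.2, fun h => ⟨?_, h⟩⟩
  rintro rfl
  simp at h

lemma wordDist_le_length {T : Set (List ℕ)} {v w : T} (q : (treeGraph T).Walk v w) :
    wordDist v w ≤ q.length := by
  induction q with
  | nil => simp [wordDist_self]
  | cons h q ih =>
    rw [SimpleGraph.Walk.length_cons]
    rcases treeGraph_adj.1 h with ⟨i, hi⟩ | ⟨i, hi⟩
    · rw [hi] at ih
      exact (wordDist_append_singleton_le _ i _).2.trans (by omega)
    · rw [hi]
      exact (wordDist_append_singleton_le _ i _).1.trans (by omega)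

lemma exists_walk_append {T : Set (List ℕ)} (hT : ∀ u i, u ++ [i] ∈ T → u ∈ T) (x y : List ℕ)
    (hy : x ++ y ∈ T) : ∃ hx : x ∈ T,
      ∃ q : (treeGraph T).Walk ⟨x, hx⟩ ⟨x ++ y, hy⟩, q.length = y.length := by
  induction y using List.reverseRecOn with
  | nil =>
    have hx : x ∈ T := by simpa using hy
    refine ⟨hx, SimpleGraph.Walk.nil.copy rfl (by simp), by simp⟩
  | append_singleton y i ih =>
    have hy' : (x ++ y) ++ [i] ∈ T := by simpa using hy
    obtain ⟨hx, q, hq⟩ := ih (hT _ _ hy')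
    have hadj : (treeGraph T).Adj ⟨x ++ y, hT _ _ hy'⟩ ⟨x ++ (y ++ [i]), hy⟩ :=
      treeGraph_adj.2 (Or.inl ⟨i, by simp⟩)
    exact ⟨hx, q.concat hadj, by simp [hq]⟩

lemma dist_treeGraph {T : Set (List ℕ)} (hT : ∀ u i, u ++ [i] ∈ T → u ∈ T) (v w : T) :
    (treeGraph T).dist v w = wordDist v w := by
  obtain ⟨v, hv⟩ := v
  obtain ⟨w, hw⟩ := w
  obtain ⟨x, y, z, rfl, rfl, hd⟩ := exists_eq_append v w
  obtain ⟨hx, q, hq⟩ := exists_walk_append hT x y hv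
  obtain ⟨_, r, hr⟩ := exists_walk_append hT x z hw
  have h := SimpleGraph.dist_le (q.reverse.append r)
  rw [SimpleGraph.Walk.length_append, SimpleGraph.Walk.length_reverse, hq, hr] at h
  refine le_antisymm (h.trans hd.ge) ?_
  -- Reachability matters here, as `dist` is 0 by default between unconnected vertices.
  obtain ⟨s, hs⟩ := (q.reverse.append r).reachable.exists_walk_length_eq_dist
  exact hs ▸ wordDist_le_length s

/-- `w` is a vertex at distance `k` from `v` which is a descendant of `v` or belongs to an
earlier branch. -/
def FarBefore (k : ℕ) : List ℕ → List ℕ → Prop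
  | [], w => w.length = k
  | _ :: _, [] => False
  | a :: v, b :: w => if a = b then FarBefore k v w else b < a ∧ v.length + w.length + 2 = k

lemma farBefore_or {k : ℕ} {v w : List ℕ} (h : wordDist v w = k) :
    FarBefore k v w ∨ FarBefore k w v := by
  induction v generalizing w with
  | nil => exact Or.inl (by rw [← h, wordDist_nil_left, FarBefore])
  | cons a v ih =>
    rcases w with _ | ⟨b, w⟩
    · exact Or.inr (by rw [← h, wordDist_nil_right, FarBefore])
    · simp only [wordDist] at h
      by_cases hab : a = b
      · subst hab
        rw [if_pos rfl] at h
        simpa [FarBefore] using ih h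
      · rw [if_neg hab] at h
        simp only [FarBefore, if_neg hab, if_neg (Ne.symm hab)]
        omega

lemma card_filter_length_verts (t : Forest) (j : ℕ) :
    ((verts t).filter fun u => u.length = j + 1).card = t.level j := by
  induction t generalizing j with
  | nil => cases j <;> simp [verts, level]
  | cons c s hc hs =>
    have h1 : (((insert [] (verts c)).image (s.len :: ·)).filter fun u => u.length = j + 1).card =
        ((insert [] (verts c)).filter fun u => u.length = j).card := by
      rw [Finset.filter_image, Finset.card_image_of_injective _ List.cons_injective]
      simp
    rw [verts, Finset.filter_union, Finset.card_union_of_disjoint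
      (Finset.disjoint_filter_filter (disjoint_verts c s)), h1, hs]
    cases j with
    | zero =>
      rw [Finset.filter_insert, if_pos (by simp), level]
      have : (verts c).filter (fun u => u.length = 0) = ∅ := by
        refine Finset.filter_eq_empty_iff.2 fun u hu h => ?_
        exact nil_notMem_verts c (List.length_eq_zero_iff.1 h ▸ hu)
      rw [this]
      simp
    | succ j => rw [Finset.filter_insert, if_neg (by simp), hc, level]

open Classical in
/-- The pairs of words of a finite set related by `FarBefore k`. -/
noncomputable def farPairs (k : ℕ) (S : Finset (List ℕ)) : Finset (List ℕ × List ℕ) :=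
  (S ×ˢ S).filter fun x => FarBefore k x.1 x.2

lemma mem_farPairs {k : ℕ} {S : Finset (List ℕ)} {v w : List ℕ} :
    (v, w) ∈ farPairs k S ↔ (v ∈ S ∧ w ∈ S) ∧ FarBefore k v w := by
  simp [farPairs]

lemma card_farPairs_insert_le {k : ℕ} (hk : 1 ≤ k) (t : Forest) :
    (farPairs k (insert [] (verts t))).card ≤ t.level (k - 1) + (farPairs k (verts t)).card := by
  classical
  have h : farPairs k (insert [] (verts t)) ⊆
      ((verts t).filter fun u => u.length = k - 1 + 1).image (fun w => ([], w)) ∪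
        farPairs k (verts t) := by
    rintro ⟨v, w⟩ h
    rw [mem_farPairs] at h
    obtain ⟨⟨hv, hw⟩, h⟩ := h
    rw [Finset.mem_insert] at hv hw
    rw [Finset.mem_union, mem_farPairs]
    rcases v with _ | ⟨a, v⟩
    · left
      simp only [FarBefore] at h
      rcases hw with rfl | hw
      · simp at h
        omega
      · exact Finset.mem_image.2 ⟨w, Finset.mem_filter.2 ⟨hw, by omega⟩, rfl⟩
    · right
      rcases w with _ | ⟨b, w⟩
      · simp [FarBefore] at h
      · exact ⟨⟨by simpa using hv, by simpa using hw⟩, h⟩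
  refine (Finset.card_le_card h).trans ((Finset.card_union_le _ _).trans ?_)
  gcongr
  exact Finset.card_image_le.trans (card_filter_length_verts t (k - 1)).le

/-- An inequality suffices. The first tree has the largest branch number `s.len`, so a mixed pair
always has its first member in that tree. -/
lemma card_farPairs_verts_le {k : ℕ} (hk : 1 ≤ k) (t : Forest) :
    (farPairs k (verts t)).card ≤ t.pairs k := by
  classical
  induction t with
  | nil => simp [farPairs, verts]
  | cons c s hc hs =>
    have h : farPairs k (verts (cons c s)) ⊆
        (farPairs k (insert [] (verts c))).image (fun x => (s.len :: x.1, s.len :: x.2)) ∪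
        (Finset.range (k - 1)).biUnion (fun i =>
          ((verts (cons c nil)).filter fun u => u.length = i + 1).image
            (fun u => s.len :: u.tail) ×ˢ
          ((verts s).filter fun u => u.length = k - 2 - i + 1)) ∪
        farPairs k (verts s) := by
      rintro ⟨v, w⟩ h
      rw [mem_farPairs] at h
      obtain ⟨⟨hv, hw⟩, h⟩ := h
      rw [verts, Finset.mem_union, Finset.mem_image] at hv hw
      simp only [Finset.mem_union, mem_farPairs]
      rcases hv with ⟨v, hv, rfl⟩ | hv
      · left
        rcases hw with ⟨w, hw, rfl⟩ | hw
        · left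
          refine Finset.mem_image.2 ⟨(v, w), mem_farPairs.2 ⟨⟨hv, hw⟩, ?_⟩, rfl⟩
          simpa [FarBefore] using h
        · right
          obtain ⟨b, w, rfl, hb⟩ := exists_of_mem_verts hw
          simp only [FarBefore, if_neg hb.ne'] at h
          refine Finset.mem_biUnion.2 ⟨v.length, Finset.mem_range.2 (by omega), ?_⟩
          -- Standing alone in `cons c nil`, the first tree has branch number 0; the image relabels
          -- it as `s.len`.
          refine Finset.mem_product.2 ⟨Finset.mem_image.2 ⟨0 :: v, ?_, rfl⟩, ?_⟩
          · exact Finset.mem_filter.2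
              ⟨Finset.mem_union_left _ (Finset.mem_image_of_mem _ hv), rfl⟩
          · exact Finset.mem_filter.2 ⟨hw, by simp only [List.length_cons]; omega⟩
      · right
        obtain ⟨a, v, rfl, ha⟩ := exists_of_mem_verts hv
        rcases hw with ⟨w, hw, rfl⟩ | hw
        · simp only [FarBefore, if_neg ha.ne] at h
          omega
        · exact ⟨⟨hv, hw⟩, h⟩
    refine (Finset.card_le_card h).trans ((Finset.card_union_le _ _).trans ?_)
    rw [pairs]
    refine add_le_add ((Finset.card_union_le _ _).trans (add_le_add ?_ ?_)) hs
    · exact Finset.card_image_le.trans ((card_farPairs_insert_le hk c).trans (by omega))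
    · refine Finset.card_biUnion_le.trans (Finset.sum_le_sum fun i _ => ?_)
      rw [Finset.card_product, card_filter_length_verts]
      gcongr
      exact Finset.card_image_le.trans (card_filter_length_verts _ i).le

lemma append_singleton_mem_familyTree {ω : Sample} {u : List ℕ} {i : ℕ}
    (h : u ++ [i] ∈ familyTree ω) : u ∈ familyTree ω :=
  fun w j hw => h w j (hw.trans (List.prefix_append _ _))

lemma pairsAtDist_le {k : ℕ} (hk : 1 ≤ k) {t : Forest} {ω : Sample} (h : TreeRepresents t ω) :
    pairsAtDist k (familyTree ω) ≤ (t.level (k - 1) + t.pairs k : ℕ) := by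
  set T := familyTree ω with hT
  have hdist := dist_treeGraph (T := T) fun _ _ => append_singleton_mem_familyTree
  let P : Set (T × T) := {x | FarBefore k x.1 x.2}
  have h1 : {e : Sym2 T | ∃ v w : T, e = s(v, w) ∧ (treeGraph T).dist v w = k} ⊆
      (fun x : T × T => s(x.1, x.2)) '' P := by
    rintro _ ⟨v, w, rfl, hd⟩
    rw [hdist] at hd
    rcases farBefore_or hd with h | h
    · exact ⟨(v, w), h, rfl⟩
    · exact ⟨(w, v), h, Sym2.eq_swap⟩
  have hinj : Function.Injective fun x : T × T => ((x.1 : List ℕ), (x.2 : List ℕ)) :=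
    fun x y hxy => by
      simp only [Prod.mk.injEq, Subtype.val_inj] at hxy
      exact Prod.ext hxy.1 hxy.2
  have h2 : (fun x : T × T => ((x.1 : List ℕ), (x.2 : List ℕ))) '' P ⊆
      ↑(farPairs k (insert [] (verts t))) := by
    rintro _ ⟨⟨⟨v, hv⟩, ⟨w, hw⟩⟩, hx, rfl⟩
    rw [hT, familyTree_eq h] at hv hw
    exact mem_farPairs.2 ⟨⟨hv, hw⟩, hx⟩
  calc pairsAtDist k T ≤ ((fun x : T × T => s(x.1, x.2)) '' P).encard := Set.encard_le_encard h1
    _ ≤ P.encard := Set.encard_image_le _ _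
    _ = ((fun x : T × T => ((x.1 : List ℕ), (x.2 : List ℕ))) '' P).encard :=
      (hinj.encard_image _).symm
    _ ≤ (farPairs k (insert [] (verts t))).card :=
      (Set.encard_le_encard h2).trans (Set.encard_coe_eq_coe_finsetCard _).le
    _ ≤ _ := Nat.cast_le.2 ((card_farPairs_insert_le hk t).trans
      (Nat.add_le_add_left (card_farPairs_verts_le hk t) _))

end Distance

/-! ### Expectations as coefficients -/

section Expectation

open Forest PowerSeries

/-- A represented forest t stands for the tree `cons t nil`, whose root accounts for the extra 1 in
the size and for the factor μ {t.len} in the law. -/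
lemma series_treeRepresents (μ : Measure ℕ) [IsProbabilityMeasure μ] (f : Forest → ℝ≥0∞)
    (g : Forest → ℝ≥0∞) (hg : ∀ c, g (cons c nil) = f c) (n : ℕ) :
    ∑' t : {t : Forest // 1 + t.size = n}, law μ {ω | TreeRepresents t ω} * f t =
      coeff n (gf (fun d => μ {d}) 1 g) := by
  rw [gf_one_tree _ f g hg, X_mul_wsum_gf, series, coeff_mk]
  simp only [law_treeRepresents]
  refine (tsum_subtype {t : Forest | 1 + t.size = n}
    fun t => μ {t.len} * t.wt (fun d => μ {d}) * f t).trans (tsum_congr fun t => ?_)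
  simp [Set.indicator_apply]

lemma sizeEvent_eq (n : ℕ) : sizeEvent n =
    ⋃ t : {t : Forest // 1 + t.size = n}, {ω | TreeRepresents t ω} := by
  ext ω
  simp only [sizeEvent, Set.mem_ofPred_eq, Set.mem_iUnion, Subtype.exists, exists_prop]
  constructor
  · intro h
    obtain ⟨t, ht⟩ := exists_treeRepresents h.le
    rw [encard_familyTree ht] at h
    exact ⟨t, by exact_mod_cast h, ht⟩
  · rintro ⟨t, rfl, ht⟩
    exact encard_familyTree ht

lemma disjoint_treeRepresents (n : ℕ) : Pairwise (Function.onFun Disjoint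
    fun t : {t : Forest // 1 + t.size = n} => {ω | TreeRepresents t ω}) := by
  intro t t' h
  rw [Function.onFun, Set.disjoint_left]
  exact fun ω hω hω' => h (Subtype.ext (eq_of_treeRepresents hω hω'))

lemma law_sizeEvent (μ : Measure ℕ) [IsProbabilityMeasure μ] (n : ℕ) :
    law μ (sizeEvent n) = coeff n (treeGF fun d => μ {d}) := by
  rw [treeGF, ← series_treeRepresents μ 1 1 (fun _ => rfl), sizeEvent_eq,
    measure_iUnion (disjoint_treeRepresents n) fun t => measurableSet_treeRepresents t]
  simp

lemma setLIntegral_pairsAtDist_le (μ : Measure ℕ) [IsProbabilityMeasure μ] (n : ℕ) {k : ℕ}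
    (hk : 1 ≤ k) : ∫⁻ ω in sizeEvent n, (pairsAtDist k (familyTree ω) : ℝ≥0∞) ∂(law μ) ≤
      coeff n (gf (fun d => μ {d}) 1 (fun t => t.pairs k)) := by
  rw [← series_treeRepresents μ (fun t => (t.level (k - 1) + t.pairs k : ℕ)) _
    (fun c => by simp [pairs, level]), sizeEvent_eq,
    lintegral_iUnion (fun t : {t : Forest // 1 + t.size = n} => measurableSet_treeRepresents t.1)
      (disjoint_treeRepresents n)]
  refine ENNReal.tsum_le_tsum fun t => ?_
  rw [mul_comm, ← setLIntegral_const]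
  refine setLIntegral_mono' (measurableSet_treeRepresents t.1) fun ω hω => ?_
  have := ENat.toENNReal_le.2 (pairsAtDist_le hk hω)
  simpa using this

lemma expectedPairs_eq (μ : Measure ℕ) [IsProbabilityMeasure μ] (n k : ℕ) :
    expectedPairs μ n k = (law μ (sizeEvent n))⁻¹ *
      ∫⁻ ω in sizeEvent n, (pairsAtDist k (familyTree ω) : ℝ≥0∞) ∂(law μ) := by
  rw [expectedPairs, condLaw, ProbabilityTheory.cond, lintegral_smul_measure, smul_eq_mul]

/-- If the local probabilities of the walk are comparable, then so are the expected numbers of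
pairs. -/
lemma expectedPairs_le (μ : Measure ℕ) [IsProbabilityMeasure μ] (C : ℝ≥0∞) {m k : ℕ} (hk : 1 ≤ k)
    (hC : ∀ d, coeff m (X ^ d * weightGF (fun d => μ {d}) ^ m) ≤
      C * coeff m (weightGF (fun d => μ {d}) ^ (m + 1))) :
    expectedPairs μ (m + 1) k ≤
      (1 + C * ∑' e, μ {e} * e.choose 2) * (m + 1 : ℕ) * k := by
  set p : ℕ → ℝ≥0∞ := fun d => μ {d} with hp
  set q := law μ (sizeEvent (m + 1)) with hq
  have ha : coeff m (weightGF p ^ (m + 1)) = (m + 1 : ℕ) * q := by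
    rw [← succ_mul_coeff_treeGF, hq, law_sizeEvent]
  rw [ha] at hC
  have h1 : ∑' e, p e * (e.choose 2 * coeff m (X ^ e * weightGF p ^ m)) ≤
      C * (∑' e, p e * e.choose 2) * (m + 1 : ℕ) * q := by
    rw [mul_assoc, mul_comm C, mul_assoc, ← ENNReal.tsum_mul_right]
    refine ENNReal.tsum_le_tsum fun e => ?_
    rw [← mul_assoc]
    gcongr
    exact (hC e).trans_eq (by ring)
  have hk' : ((k - 1 : ℕ) : ℝ≥0∞) ≤ k := Nat.cast_le.2 (Nat.sub_le _ _)
  have hk1 : (1 : ℝ≥0∞) ≤ k := Nat.one_le_cast.2 hk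
  rw [expectedPairs_eq, mul_comm, ← div_eq_mul_inv]
  refine ENNReal.div_le_of_le_mul ?_
  calc _ ≤ _ := setLIntegral_pairsAtDist_le μ (m + 1) hk
    _ ≤ _ := coeff_gf_pairs_le p hk m
    _ ≤ (m + 1 : ℕ) * q * k + k * (C * (∑' e, p e * e.choose 2) * (m + 1 : ℕ) * q) := by
      rw [ha]
      exact add_le_add (le_mul_of_one_le_right' hk1) (mul_le_mul' hk' h1)
    _ = _ := by ring

lemma tsum_choose_two_ne_top (μ : Measure ℕ) [IsProbabilityMeasure μ]
    (hL2 : MemLp (fun x : ℕ => (x : ℝ)) 2 μ) : ∑' e, μ {e} * (e.choose 2 : ℝ≥0∞) ≠ ⊤ := by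
  have h := hL2.eLpNorm_lt_top
  rw [eLpNorm_lt_top_iff_lintegral_rpow_enorm_lt_top (by simp) (by simp), lintegral_countable'] at h
  refine ne_top_of_le_ne_top h.ne (ENNReal.tsum_le_tsum fun e => ?_)
  rw [mul_comm]
  gcongr
  simp only [ENNReal.toReal_ofNat, ENNReal.rpow_ofNat, Real.enorm_natCast]
  exact_mod_cast Nat.choose_le_pow e 2

end Expectation

/-! ### Fourier inversion -/

section Fourier

open PowerSeries

/-- The sum of the coefficients. -/
noncomputable def mass (G : ℝ≥0∞⟦X⟧) : ℝ≥0∞ := ∑' j, coeff j G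

lemma mass_series {ι : Type*} (w : ι → ℝ≥0∞) (s : ι → ℕ) : mass (series w s) = ∑' i, w i := by
  simp only [mass, series, coeff_mk]
  rw [ENNReal.tsum_comm]
  simp

lemma series_coeff (G : ℝ≥0∞⟦X⟧) : series (fun j => coeff j G) id = G := by
  ext n
  simp [series]

lemma mass_mul (G H : ℝ≥0∞⟦X⟧) : mass (G * H) = mass G * mass H := by
  conv_lhs =>
    rw [← series_coeff G, ← series_coeff H, ← series_prod, mass_series, ENNReal.tsum_prod']
  simp only [ENNReal.tsum_mul_left, ENNReal.tsum_mul_right, mass]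

lemma mass_pow (G : ℝ≥0∞⟦X⟧) (m : ℕ) : mass (G ^ m) = mass G ^ m := by
  induction m with
  | zero => simp [mass, coeff_one]
  | succ m ih => rw [pow_succ, mass_mul, ih, pow_succ]

lemma coeff_le_mass (G : ℝ≥0∞⟦X⟧) (j : ℕ) : coeff j G ≤ mass G := ENNReal.le_tsum j

/-- The sum of a power series at a complex number. -/
noncomputable def evalAt (z : ℂ) (G : ℝ≥0∞⟦X⟧) : ℂ := ∑' j, ((coeff j G).toReal : ℂ) * z ^ j

lemma norm_evalAt_term {z : ℂ} (hz : ‖z‖ = 1) (G : ℝ≥0∞⟦X⟧) (j : ℕ) :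
    ‖((coeff j G).toReal : ℂ) * z ^ j‖ = (coeff j G).toReal := by
  simp [hz]

lemma evalAt_mul {z : ℂ} (hz : ‖z‖ = 1) {G H : ℝ≥0∞⟦X⟧} (hG : mass G ≠ ⊤) (hH : mass H ≠ ⊤) :
    evalAt z (G * H) = evalAt z G * evalAt z H := by
  simp only [evalAt]
  rw [tsum_mul_tsum_eq_tsum_sum_antidiagonal_of_summable_norm]
  · refine tsum_congr fun n => ?_
    rw [coeff_mul, ENNReal.toReal_sum, Complex.ofReal_sum, Finset.sum_mul]
    · refine Finset.sum_congr rfl fun x hx => ?_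
      rw [← Finset.HasAntidiagonal.mem_antidiagonal.1 hx, ENNReal.toReal_mul, Complex.ofReal_mul,
        pow_add]
      ring
    · exact fun x _ => ENNReal.mul_ne_top (ne_top_of_le_ne_top hG (coeff_le_mass G _))
        (ne_top_of_le_ne_top hH (coeff_le_mass H _))
  · simpa only [norm_evalAt_term hz] using ENNReal.summable_toReal hG
  · simpa only [norm_evalAt_term hz] using ENNReal.summable_toReal hH

lemma evalAt_pow {z : ℂ} (hz : ‖z‖ = 1) {G : ℝ≥0∞⟦X⟧} (hG : mass G ≠ ⊤) (m : ℕ) :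
    evalAt z (G ^ m) = evalAt z G ^ m := by
  induction m with
  | zero =>
    rw [evalAt, tsum_eq_single 0]
    · simp
    · intro j hj
      simp [coeff_one, hj]
  | succ m ih =>
    rw [pow_succ, evalAt_mul hz (by rw [mass_pow]; exact ENNReal.pow_ne_top hG) hG, ih, pow_succ]

lemma integral_exp_int_mul {g : ℕ} (hg : 0 < g) {r : ℤ} (hr : r ≠ 0) :
    ∫ t in (-(Real.pi / g))..(Real.pi / g), Complex.exp ((g * r * Complex.I) * t) = 0 := by
  have hg' : (g : ℂ) ≠ 0 := by exact_mod_cast hg.ne'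
  rw [integral_exp_mul_complex (by simp [hg', hr])]
  have h1 : (g * r * Complex.I : ℂ) * ((Real.pi / g : ℝ) : ℂ) =
      (g * r * Complex.I : ℂ) * ((-(Real.pi / g) : ℝ) : ℂ) + r * (2 * Real.pi * Complex.I) := by
    push_cast
    field_simp
    ring
  rw [h1, Complex.exp_add, Complex.exp_int_mul_two_pi_mul_I]
  simp

/-- Fourier inversion for power series supported on the multiples of `g`. -/
lemma integral_evalAt {g : ℕ} (hg : 0 < g) {G : ℝ≥0∞⟦X⟧} (hG : mass G ≠ ⊤)
    (hdvd : ∀ l, coeff l G ≠ 0 → g ∣ l) {j : ℕ} (hj : g ∣ j) :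
    ∫ t in (-(Real.pi / g))..(Real.pi / g),
      evalAt (Complex.exp (t * Complex.I)) G * Complex.exp (-(j * t * Complex.I)) =
      (2 * Real.pi / g * (coeff j G).toReal : ℝ) := by
  have hterm : ∀ (l : ℕ) (t : ℝ), ((coeff l G).toReal : ℂ) * Complex.exp (t * Complex.I) ^ l *
      Complex.exp (-(j * t * Complex.I)) =
      (coeff l G).toReal * Complex.exp ((((l : ℤ) - j : ℤ) * Complex.I : ℂ) * t) := by
    intro l t
    rw [← Complex.exp_nat_mul, mul_assoc, ← Complex.exp_add]
    push_cast
    ring_nf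
  have hs := ENNReal.summable_toReal hG
  have key := intervalIntegral.hasSum_integral_of_dominated_convergence (a := -(Real.pi / g))
    (b := Real.pi / g) (μ := volume)
    (F := fun (l : ℕ) (t : ℝ) => ((coeff l G).toReal : ℂ) * Complex.exp (t * Complex.I) ^ l *
      Complex.exp (-(j * t * Complex.I)))
    (f := fun t => evalAt (Complex.exp (t * Complex.I)) G * Complex.exp (-(j * t * Complex.I)))
    (fun l _ => (coeff l G).toReal)
    (fun l => by
      refine Continuous.aestronglyMeasurable ?_
      fun_prop)
    (fun l => Filter.Eventually.of_forall fun t _ => by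
      have : ‖Complex.exp (-(j * t * Complex.I))‖ = 1 := by
        rw [show -(j * t * Complex.I : ℂ) = ((-(j * t) : ℝ) : ℂ) * Complex.I by push_cast; ring]
        exact Complex.norm_exp_ofReal_mul_I _
      rw [norm_mul, this, norm_evalAt_term (Complex.norm_exp_ofReal_mul_I _), mul_one])
    (Filter.Eventually.of_forall fun t _ => hs) intervalIntegrable_const
    (Filter.Eventually.of_forall fun t _ => by
      refine HasSum.mul_right _ (Summable.hasSum (Summable.of_norm ?_))
      simpa only [norm_evalAt_term (Complex.norm_exp_ofReal_mul_I t)] using hs)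
  -- Frequencies l - j with nonzero coefficient are multiples of g, so all but l = j integrate to
  -- zero over a period 2π/g.
  rw [← key.tsum_eq, tsum_eq_single j]
  · simp only [hterm, sub_self, Int.cast_zero, zero_mul, Complex.exp_zero, mul_one]
    rw [intervalIntegral.integral_const, Complex.real_smul]
    push_cast
    ring
  · intro l hl
    simp only [hterm]
    rw [intervalIntegral.integral_const_mul]
    by_cases h0 : coeff l G = 0
    · simp [h0]
    obtain ⟨r, hr⟩ : (g : ℤ) ∣ (l : ℤ) - j :=
      dvd_sub (by exact_mod_cast hdvd l h0) (by exact_mod_cast hj)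
    have hr0 : r ≠ 0 := by
      rintro rfl
      omega
    have := integral_exp_int_mul hg hr0
    rw [hr]
    push_cast
    rw [this, mul_zero]

end Fourier

/-! ### The characteristic function -/

section CharacteristicFunction

open PowerSeries Filter Topology

/-- The generating function of a probability measure on `ℕ`. -/
noncomputable def pgf (μ : Measure ℕ) : ℝ≥0∞⟦X⟧ := weightGF fun d => μ {d}

variable (μ : Measure ℕ)

lemma mass_pgf [IsProbabilityMeasure μ] : mass (pgf μ) = 1 := by
  simp only [mass, pgf, weightGF, coeff_mk]
  have h := Measure.tsum_indicator_apply_singleton μ Set.univ MeasurableSet.univ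
  simpa using h

/-- The characteristic function of a measure on `ℕ`. -/
noncomputable def charNat (t : ℝ) : ℂ := ∫ x : ℕ, Complex.exp (t * x * Complex.I) ∂μ

lemma norm_exp_mul_natCast (t : ℝ) (x : ℕ) : ‖Complex.exp (t * x * Complex.I)‖ = 1 := by
  rw [show (t * x * Complex.I : ℂ) = ((t * x : ℝ) : ℂ) * Complex.I by push_cast; ring]
  exact Complex.norm_exp_ofReal_mul_I _

lemma evalAt_pgf [IsProbabilityMeasure μ] (t : ℝ) :
    evalAt (Complex.exp (t * Complex.I)) (pgf μ) = charNat μ t := by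
  have hi : Integrable (fun x : ℕ => Complex.exp (t * x * Complex.I)) μ :=
    Integrable.of_bound (by fun_prop) 1
      (Eventually.of_forall fun x => (norm_exp_mul_natCast t x).le)
  rw [charNat, integral_countable hi, evalAt]
  refine tsum_congr fun x => ?_
  rw [pgf, weightGF, coeff_mk, ← Complex.exp_nat_mul, Complex.real_smul, measureReal_def]
  congr 2
  ring

/-- The multiples of the span of the distribution support it, and the characteristic function has
modulus less than one on a period. -/
lemma exists_span [IsProbabilityMeasure μ] (h0 : μ {0} ≠ 0) (h1 : ∃ d ≠ 0, μ {d} ≠ 0) :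
    ∃ g : ℕ, 0 < g ∧
    (∀ d, μ {d} ≠ 0 → g ∣ d) ∧ ∀ t : ℝ, |t| ≤ Real.pi / g → t ≠ 0 → ‖charNat μ t‖ < 1 := by
  -- As 0 is an atom, the group generated by the support is also the one generated by its
  -- differences, so its generator is the span.
  let S : Set ℤ := {n | ∃ d : ℕ, n = d ∧ μ {d} ≠ 0}
  obtain ⟨a, ha⟩ := Int.subgroup_cyclic (AddSubgroup.closure S)
  have hdvd : ∀ d : ℕ, μ {d} ≠ 0 → a ∣ d := fun d hd => by
    have : (d : ℤ) ∈ AddSubgroup.closure {a} := ha ▸ AddSubgroup.subset_closure ⟨d, rfl, hd⟩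
    rw [← AddSubgroup.zmultiples_eq_closure, Int.mem_zmultiples_iff] at this
    exact this
  have ha0 : a ≠ 0 := by
    rintro rfl
    obtain ⟨d, hd0, hd⟩ := h1
    exact hd0 (by simpa using hdvd d hd)
  refine ⟨a.natAbs, Int.natAbs_pos.2 ha0, fun d hd => Int.natAbs_dvd_natAbs.2 (hdvd d hd),
    fun t ht ht0 => ?_⟩
  rcases ae_eq_const_or_norm_integral_lt_of_norm_le_const (μ := μ) (C := 1)
    (f := fun x : ℕ => Complex.exp (t * x * Complex.I))
    (Eventually.of_forall fun x => (norm_exp_mul_natCast t x).le) with h | h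
  · exfalso
    -- Modulus one forces the exponential to be constant on the support, and its value at the atom 0
    -- is 1.
    have hconst : ∀ d, μ {d} ≠ 0 → Complex.exp (t * d * Complex.I) = 1 := by
      have hval : ∀ d, μ {d} ≠ 0 → Complex.exp (t * d * Complex.I) =
          ⨍ x : ℕ, Complex.exp (t * x * Complex.I) ∂μ := by
        intro d hd
        by_contra hne
        exact hd (measure_mono_null (by simpa using hne) (ae_iff.1 h))
      intro d hd
      rw [hval d hd, ← hval 0 h0]
      simp
    let H : AddSubgroup ℤ :=
      { carrier := {n | Complex.exp (t * n * Complex.I) = 1}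
        zero_mem' := by simp
        add_mem' := fun {m n} hm hn => by
          have : (t * ((m + n : ℤ) : ℂ) * Complex.I : ℂ) =
            t * m * Complex.I + t * n * Complex.I := by push_cast; ring
          simp only [Set.mem_ofPred_eq] at hm hn ⊢
          rw [this, Complex.exp_add, hm, hn, one_mul]
        neg_mem' := fun {m} hm => by
          have : (t * ((-m : ℤ) : ℂ) * Complex.I : ℂ) = -(t * m * Complex.I) := by push_cast; ring
          simp only [Set.mem_ofPred_eq] at hm ⊢
          rw [this, Complex.exp_neg, hm, inv_one] }
    have hS : AddSubgroup.closure S ≤ H := by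
      rw [AddSubgroup.closure_le]
      rintro _ ⟨d, rfl, hd⟩
      simpa [H] using hconst d hd
    have haH : a ∈ H := hS (ha ▸ AddSubgroup.subset_closure rfl)
    obtain ⟨n, hn⟩ := Complex.exp_eq_one_iff.1 (show Complex.exp (t * a * Complex.I) = 1 from haH)
    have hn' : t * a = n * (2 * Real.pi) := by
      have : (t * a : ℂ) = n * (2 * Real.pi) :=
        mul_right_cancel₀ Complex.I_ne_zero (by rw [hn]; ring)
      exact_mod_cast this
    have hapos : (0 : ℝ) < |(a : ℝ)| := abs_pos.2 (by exact_mod_cast ha0)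
    have hle : |t * a| ≤ Real.pi := by
      rw [Nat.cast_natAbs, Int.cast_abs, le_div_iff₀ hapos, ← abs_mul] at ht
      exact ht
    have hn0 : n = 0 := by
      by_contra hne
      have h1 : (1 : ℝ) ≤ |(n : ℝ)| := by exact_mod_cast Int.one_le_abs hne
      rw [hn', abs_mul, abs_of_pos Real.two_pi_pos] at hle
      nlinarith [Real.pi_pos]
    rw [hn0, Int.cast_zero, zero_mul, mul_eq_zero] at hn'
    exact hn'.elim ht0 (by exact_mod_cast ha0)
  · simpa [charNat] using h

lemma dvd_of_coeff_pgf_pow {g : ℕ} (hg : ∀ d, μ {d} ≠ 0 → g ∣ d) (m l : ℕ)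
    (h : coeff l (pgf μ ^ m) ≠ 0) : g ∣ l := by
  induction m generalizing l with
  | zero =>
    obtain rfl : l = 0 := by
      by_contra hl
      simp [coeff_one, hl] at h
    exact dvd_zero g
  | succ m ih =>
    rw [pow_succ, coeff_mul] at h
    obtain ⟨x, hx, hne⟩ := Finset.exists_ne_zero_of_sum_ne_zero h
    rw [← Finset.HasAntidiagonal.mem_antidiagonal.1 hx]
    refine dvd_add (ih _ (left_ne_zero_of_mul hne)) (hg _ ?_)
    simpa [pgf, weightGF] using right_ne_zero_of_mul hne

variable {μ} in
-- Without mass at 0 the variable is at least 1 with mean 1, hence a.s. equal to 1, against positive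
-- variance.
lemma measure_zero_ne_zero [IsProbabilityMeasure μ] (hL2 : MemLp (fun x : ℕ => (x : ℝ)) 2 μ)
    (hmean : ∫ x : ℕ, (x : ℝ) ∂μ = 1)
    (hvar : 0 < variance (fun x : ℕ => (x : ℝ)) μ) : μ {0} ≠ 0 := by
  intro h0
  have hint : Integrable (fun x : ℕ => (x : ℝ)) μ := hL2.integrable (by norm_num)
  have hpos : ∀ᵐ x : ℕ ∂μ, x ≠ 0 := by
    rw [ae_iff]
    simpa using h0
  have h1 : ∫ x : ℕ, ((x : ℝ) - 1) ∂μ = 0 := by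
    rw [integral_sub hint (integrable_const _), hmean]
    simp
  rw [integral_eq_zero_iff_of_nonneg_ae (f := fun x : ℕ => (x : ℝ) - 1) _
    (hint.sub (integrable_const _))] at h1
  · have h2 : variance (fun x : ℕ => (x : ℝ)) μ = variance (fun _ : ℕ => (1 : ℝ)) μ :=
      variance_congr (h1.mono fun x hx => sub_eq_zero.1 hx)
    rw [h2, variance_eq_integral (by fun_prop)] at hvar
    simp at hvar
  · filter_upwards [hpos] with x hx
    have : (1 : ℝ) ≤ x := by exact_mod_cast Nat.one_le_iff_ne_zero.2 hx
    simpa using this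

variable {μ} in
lemma exists_measure_ne_zero [IsProbabilityMeasure μ] (hmean : ∫ x : ℕ, (x : ℝ) ∂μ = 1) :
    ∃ d ≠ 0, μ {d} ≠ 0 := by
  by_contra! h
  have h0 : ∀ᵐ x : ℕ ∂μ, (x : ℝ) = 0 := by
    refine ae_iff_of_countable.2 fun d hd => ?_
    by_contra hd0
    exact hd (h d (by exact_mod_cast hd0))
  rw [integral_congr_ae h0] at hmean
  simp at hmean

/-- The standardized offspring number. -/
noncomputable def standardized (x : ℕ) : ℝ :=
  (x - 1) / √(variance (fun x : ℕ => (x : ℝ)) μ)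

lemma charNat_eq (t : ℝ) (hvar : 0 < variance (fun x : ℕ => (x : ℝ)) μ) :
    charNat μ t = charFun (μ.map (standardized μ)) (√(variance (fun x : ℕ => (x : ℝ)) μ) * t) *
      Complex.exp (t * Complex.I) := by
  have hσ : (√(variance (fun x : ℕ => (x : ℝ)) μ) : ℂ) ≠ 0 := by
    exact_mod_cast (Real.sqrt_pos.2 hvar).ne'
  rw [charFun_apply_real, integral_map (by fun_prop) (by fun_prop), ← integral_mul_const, charNat]
  refine integral_congr_ae (Eventually.of_forall fun x => ?_)
  simp only [standardized]
  rw [← Complex.exp_add]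
  congr 1
  push_cast
  field_simp
  ring

variable {μ} in
lemma integral_standardized [IsProbabilityMeasure μ] (hL2 : MemLp (fun x : ℕ => (x : ℝ)) 2 μ)
    (hmean : ∫ x : ℕ, (x : ℝ) ∂μ = 1) : ∫ x, standardized μ x ∂μ = 0 := by
  have hint : Integrable (fun x : ℕ => (x : ℝ)) μ := hL2.integrable (by norm_num)
  simp only [standardized]
  rw [integral_div, integral_sub hint (integrable_const _), hmean]
  simp

variable {μ} in
lemma integral_standardized_sq (hmean : ∫ x : ℕ, (x : ℝ) ∂μ = 1)
    (hvar : 0 < variance (fun x : ℕ => (x : ℝ)) μ) : ∫ x, (standardized μ ^ 2) x ∂μ = 1 := by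
  simp only [Pi.pow_apply, standardized, div_pow]
  rw [integral_div, Real.sq_sqrt hvar.le, div_eq_one_iff_eq hvar.ne',
    variance_eq_integral (by fun_prop), hmean]

/-- Near 0 the second-order Taylor expansion gives Gaussian decay; on the rest of the compact range
the modulus stays below some ρ < 1. -/
lemma exists_charFun_decay [IsProbabilityMeasure μ] (hL2 : MemLp (fun x : ℕ => (x : ℝ)) 2 μ)
    (hmean : ∫ x : ℕ, (x : ℝ) ∂μ = 1)
    (hvar : 0 < variance (fun x : ℕ => (x : ℝ)) μ) {R : ℝ}
    (hR : ∀ u, |u| ≤ R → u ≠ 0 → ‖charFun (μ.map (standardized μ)) u‖ < 1) :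
    ∃ c > 0, ∀ u, |u| ≤ R → ‖charFun (μ.map (standardized μ)) u‖ ≤ Real.exp (-c * u ^ 2) := by
  set χ := charFun (μ.map (standardized μ)) with hχ
  have hcont : Continuous χ := by
    have : IsProbabilityMeasure (μ.map (standardized μ)) :=
      Measure.isProbabilityMeasure_map (by fun_prop)
    exact continuous_charFun
  have h2 := taylor_charFun_two (P := μ) (X := standardized μ) (by fun_prop)
    (integral_standardized hL2 hmean) (integral_standardized_sq hmean hvar)
  obtain ⟨δ, hδ, hnear⟩ : ∃ δ > 0, ∀ u : ℝ, |u| < δ → ‖χ u‖ ≤ Real.exp (-(1 / 4) * u ^ 2) := by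
    -- An error of u²/4 leaves 1 - u²/2 + u²/4 = 1 - u²/4 ≤ exp(-u²/4).
    have h3 := h2.def (c := 1 / 4) (by norm_num)
    obtain ⟨δ, hδ, hb⟩ := Metric.eventually_nhds_iff.1 h3
    refine ⟨min δ 1, by positivity, fun u hu => ?_⟩
    have hb' := hb (show dist u 0 < δ by simpa using hu.trans_le (min_le_left _ _))
    have hu1 : u ^ 2 ≤ 1 := by
      rw [← sq_abs]
      have := hu.le.trans (min_le_right δ 1)
      nlinarith [abs_nonneg u]
    have hn : ‖(1 - (u : ℂ) ^ 2 / 2)‖ = 1 - u ^ 2 / 2 := by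
      rw [show (1 - (u : ℂ) ^ 2 / 2) = ((1 - u ^ 2 / 2 : ℝ) : ℂ) by push_cast; ring,
        Complex.norm_real, Real.norm_of_nonneg (by linarith)]
    have h4 : ‖χ u‖ ≤ ‖χ u - (1 - (u : ℂ) ^ 2 / 2)‖ + ‖(1 - (u : ℂ) ^ 2 / 2)‖ := by
      have := norm_add_le (χ u - (1 - (u : ℂ) ^ 2 / 2)) (1 - (u : ℂ) ^ 2 / 2)
      rwa [sub_add_cancel] at this
    rw [Real.norm_of_nonneg (sq_nonneg u)] at hb'
    have := Real.add_one_le_exp (-(1 / 4) * u ^ 2)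
    linarith
  have hK : IsCompact {u : ℝ | δ ≤ |u| ∧ |u| ≤ R} := by
    refine (isCompact_Icc (a := -R) (b := R)).of_isClosed_subset ?_ fun u hu => abs_le.1 hu.2
    exact (isClosed_le continuous_const continuous_abs).inter
      (isClosed_le continuous_abs continuous_const)
  obtain ⟨ρ, hρ, hfar⟩ : ∃ ρ : ℝ, (0 < ρ ∧ ρ < 1) ∧ ∀ u, δ ≤ |u| → |u| ≤ R → ‖χ u‖ ≤ ρ := by
    rcases Set.eq_empty_or_nonempty {u : ℝ | δ ≤ |u| ∧ |u| ≤ R} with he | hne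
    · refine ⟨1 / 2, by norm_num, fun u h1 h2 => ?_⟩
      exact absurd (show u ∈ {u : ℝ | δ ≤ |u| ∧ |u| ≤ R} from ⟨h1, h2⟩) (by simp [he])
    · obtain ⟨v, hv, hmax⟩ := hK.exists_isMaxOn hne hcont.norm.continuousOn
      have hv1 := hR v hv.2 (by rintro rfl; simp at hv; linarith [hv.1])
      -- The 1/2 keeps ρ positive, so that its logarithm can be used.
      refine ⟨max ‖χ v‖ (1 / 2), ⟨by positivity, max_lt hv1 (by norm_num)⟩, fun u h1 h2 => ?_⟩
      exact (hmax (show u ∈ {u : ℝ | δ ≤ |u| ∧ |u| ≤ R} from ⟨h1, h2⟩)).trans (le_max_left _ _)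
  have hlog : 0 < -Real.log ρ := neg_pos.2 (Real.log_neg hρ.1 hρ.2)
  refine ⟨min (1 / 4) (-Real.log ρ / (R ^ 2 + 1)), by positivity, fun u hu => ?_⟩
  rcases lt_or_ge |u| δ with h | h
  · refine (hnear u h).trans (Real.exp_le_exp.2 ?_)
    have := min_le_left (1 / 4) (-Real.log ρ / (R ^ 2 + 1))
    nlinarith [sq_nonneg u]
  · refine (hfar u h hu).trans ?_
    rw [← Real.exp_log hρ.1, Real.exp_le_exp, Real.log_exp]
    have h1 := min_le_right (1 / 4) (-Real.log ρ / (R ^ 2 + 1))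
    have h2 : u ^ 2 ≤ R ^ 2 + 1 := by
      rw [← sq_abs]
      nlinarith [abs_nonneg u]
    have h3 : min (1 / 4) (-Real.log ρ / (R ^ 2 + 1)) * u ^ 2 ≤ -Real.log ρ :=
      calc _ ≤ (-Real.log ρ / (R ^ 2 + 1)) * (R ^ 2 + 1) := by gcongr
        _ = _ := by field_simp
    linarith

end CharacteristicFunction

/-! ### Local probabilities -/

section LocalLimit

open PowerSeries Filter Topology

variable {μ : Measure ℕ} [IsProbabilityMeasure μ]

lemma integral_charNat_pow {g : ℕ} (hg : 0 < g) (hdvd : ∀ d, μ {d} ≠ 0 → g ∣ d) (m : ℕ) {j : ℕ}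
    (hj : g ∣ j) : ∫ t in (-(Real.pi / g))..(Real.pi / g),
      charNat μ t ^ m * Complex.exp (-(j * t * Complex.I)) =
      (2 * Real.pi / g * (coeff j (pgf μ ^ m)).toReal : ℝ) := by
  have hm : mass (pgf μ) ≠ ⊤ := by simp [mass_pgf]
  rw [← integral_evalAt hg (by simp [mass_pow, mass_pgf]) (dvd_of_coeff_pgf_pow μ hdvd m) hj]
  simp only [evalAt_pow (Complex.norm_exp_ofReal_mul_I _) hm, evalAt_pgf]

/-- The local probabilities are bounded by a multiple of `1 / √m`. -/
lemma exists_coeff_pgf_pow_le {g : ℕ} (hg : 0 < g) (hdvd : ∀ d, μ {d} ≠ 0 → g ∣ d) {c : ℝ}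
    (hc : 0 < c) (hdecay : ∀ t, |t| ≤ Real.pi / g → ‖charNat μ t‖ ≤ Real.exp (-c * t ^ 2)) :
    ∃ K : ℝ, 0 < K ∧ ∀ m : ℕ, 0 < m → ∀ j, (coeff j (pgf μ ^ m)).toReal ≤ K / √m := by
  have hg' : (0 : ℝ) < g := by exact_mod_cast hg
  -- g/(2π) is the inversion constant; the rest comes from the Gaussian integral √(π/(cm)).
  refine ⟨g / (2 * Real.pi) * √(Real.pi / c), by positivity, fun m hm j => ?_⟩
  have hm' : (0 : ℝ) < m := by exact_mod_cast hm
  by_cases hj : g ∣ j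
  · have hle : -(Real.pi / g) ≤ Real.pi / g := by
      have : 0 < Real.pi / g := by positivity
      linarith
    have hgauss : Integrable fun t : ℝ => Real.exp (-(c * m) * t ^ 2) :=
      integrable_exp_neg_mul_sq (by positivity)
    have h1 : 2 * Real.pi / g * (coeff j (pgf μ ^ m)).toReal ≤ √(Real.pi / (c * m)) := by
      calc _ = ‖((2 * Real.pi / g * (coeff j (pgf μ ^ m)).toReal : ℝ) : ℂ)‖ := by
            rw [Complex.norm_real, Real.norm_of_nonneg (by positivity)]
        _ ≤ ∫ t in (-(Real.pi / g))..(Real.pi / g), Real.exp (-(c * m) * t ^ 2) := by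
            rw [← integral_charNat_pow hg hdvd m hj]
            refine intervalIntegral.norm_integral_le_of_norm_le hle
              (Eventually.of_forall fun t ht => ?_) hgauss.intervalIntegrable
            have h2 : ‖Complex.exp (-(j * t * Complex.I))‖ = 1 := by
              rw [show (-(j * t * Complex.I) : ℂ) = ((-(j * t) : ℝ) : ℂ) * Complex.I by
                push_cast; ring]
              exact Complex.norm_exp_ofReal_mul_I _
            rw [norm_mul, h2, mul_one, norm_pow]
            refine (pow_le_pow_left₀ (norm_nonneg _)
              (hdecay t (abs_le.2 ⟨ht.1.le, ht.2⟩)) m).trans_eq ?_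
            rw [← Real.exp_nat_mul]
            congr 1
            ring
        _ ≤ ∫ t, Real.exp (-(c * m) * t ^ 2) := by
            rw [intervalIntegral.integral_of_le hle]
            exact setIntegral_le_integral hgauss (Eventually.of_forall fun t => (Real.exp_pos _).le)
        _ = _ := integral_gaussian _
    have h2 : √(Real.pi / (c * m)) = √(Real.pi / c) / √m := by
      rw [← div_div, Real.sqrt_div' _ hm'.le]
    rw [h2] at h1
    calc _ = g / (2 * Real.pi) * (2 * Real.pi / g * (coeff j (pgf μ ^ m)).toReal) := by
          field_simp
      _ ≤ g / (2 * Real.pi) * (√(Real.pi / c) / √m) := by gcongr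
      _ = _ := by ring
  · rw [not_imp_comm.1 (dvd_of_coeff_pgf_pow μ hdvd m j) hj, ENNReal.toReal_zero]
    positivity

/-- The integral in the inversion formula for the local probabilities near the mean, rescaled. -/
lemma tendsto_integral_charFun_pow (hL2 : MemLp (fun x : ℕ => (x : ℝ)) 2 μ)
    (hmean : ∫ x : ℕ, (x : ℝ) ∂μ = 1)
    (hvar : 0 < variance (fun x : ℕ => (x : ℝ)) μ) {R σ c : ℝ} (hR : 0 < R) (hc : 0 < c)
    (hdecay : ∀ u, |u| ≤ R → ‖charFun (μ.map (standardized μ)) u‖ ≤ Real.exp (-c * u ^ 2)) :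
    Tendsto (fun n : ℕ => ∫ s in (-(R * √n))..(R * √n),
      charFun (μ.map (standardized μ)) ((√n)⁻¹ * s) ^ n * Complex.exp ((σ * √n)⁻¹ * s * Complex.I))
      atTop (𝓝 (√(2 * Real.pi) : ℝ)) := by
  set χ := charFun (μ.map (standardized μ)) with hχ
  have hcont : Continuous χ := by
    have : IsProbabilityMeasure (μ.map (standardized μ)) :=
      Measure.isProbabilityMeasure_map (by fun_prop)
    exact continuous_charFun
  have hlim : ((√(2 * Real.pi) : ℝ) : ℂ) = ∫ s : ℝ, Complex.exp (-s ^ 2 / 2) := by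
    rw [show 2 * Real.pi = Real.pi / (1 / 2) by ring, ← integral_gaussian,
      ← integral_complex_ofReal]
    congr 1
    funext s
    push_cast
    congr 1
    ring
  have hI : ∀ n : ℕ, ∫ s in (-(R * √n))..(R * √n),
      χ ((√n)⁻¹ * s) ^ n * Complex.exp ((σ * √n)⁻¹ * s * Complex.I) =
      ∫ s, (Set.Ioc (-(R * √n)) (R * √n)).indicator
        (fun s : ℝ => χ ((√n)⁻¹ * s) ^ n * Complex.exp ((σ * √n)⁻¹ * s * Complex.I)) s := by
    intro n
    rw [intervalIntegral.integral_of_le (by linarith [show 0 ≤ R * √(n : ℝ) by positivity]),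
      integral_indicator measurableSet_Ioc]
  simp only [hI]
  rw [hlim]
  have hnorm : ∀ (n : ℕ) (s : ℝ), ‖Complex.exp ((σ * √n)⁻¹ * s * Complex.I)‖ = 1 := by
    intro n s
    rw [show ((σ * √n)⁻¹ * s * Complex.I : ℂ) = (((σ * √n)⁻¹ * s : ℝ) : ℂ) * Complex.I by
      push_cast; ring]
    exact Complex.norm_exp_ofReal_mul_I _
  refine tendsto_integral_of_dominated_convergence (fun s => Real.exp (-c * s ^ 2)) (fun n => ?_)
    (integrable_exp_neg_mul_sq hc) (fun n => Eventually.of_forall fun s => ?_)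
    (Eventually.of_forall fun s => ?_)
  · refine AEStronglyMeasurable.indicator (Continuous.aestronglyMeasurable ?_) measurableSet_Ioc
    fun_prop
  · by_cases hs : s ∈ Set.Ioc (-(R * √n)) (R * √n)
    · have hn : (0 : ℝ) < √n := by
        by_contra h
        have h0 : √(n : ℝ) = 0 := le_antisymm (not_lt.1 h) (Real.sqrt_nonneg _)
        simp [h0] at hs
      rw [Set.indicator_of_mem hs, norm_mul, hnorm, mul_one, norm_pow]
      have habs : |(√n)⁻¹ * s| ≤ R := by
        rw [abs_mul, abs_of_pos (inv_pos.2 hn), inv_mul_le_iff₀ hn, mul_comm]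
        exact abs_le.2 ⟨hs.1.le, hs.2⟩
      refine (pow_le_pow_left₀ (norm_nonneg _) (hdecay _ habs) n).trans_eq ?_
      rw [← Real.exp_nat_mul]
      congr 1
      rw [mul_pow, inv_pow, Real.sq_sqrt (Nat.cast_nonneg n)]
      have : (n : ℝ) ≠ 0 := fun h => by simp [h] at hn
      field_simp
    · rw [Set.indicator_of_notMem hs, norm_zero]
      positivity
  -- The pointwise limit is the central limit theorem for characteristic functions; the extra phase,
  -- due to aiming at n - 1 rather than at the mean n, tends to 1.
  · have h1 := tendsto_charFun_inv_sqrt_mul_pow (P := μ) (X := standardized μ) (by fun_prop)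
      (integral_standardized hL2 hmean) (integral_standardized_sq hmean hvar) s
    have hsqrt : Tendsto (fun n : ℕ => √(n : ℝ)) atTop atTop :=
      Real.tendsto_sqrt_atTop.comp tendsto_natCast_atTop_atTop
    have h2 : Tendsto (fun n : ℕ => Complex.exp ((σ * √n)⁻¹ * s * Complex.I)) atTop (𝓝 1) := by
      have h3 : Tendsto (fun n : ℕ => (((√(n : ℝ))⁻¹ * (σ⁻¹ * s) : ℝ) : ℂ) * Complex.I) atTop
          (𝓝 (((0 * (σ⁻¹ * s) : ℝ) : ℂ) * Complex.I)) :=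
        ((Complex.continuous_ofReal.tendsto _).comp
          ((tendsto_inv_atTop_zero.comp hsqrt).mul_const _)).mul_const _
      have h4 := (Complex.continuous_exp.tendsto _).comp h3
      simp only [zero_mul, Complex.ofReal_zero, Complex.exp_zero] at h4
      refine h4.congr fun n => ?_
      simp only [Function.comp_apply]
      congr 1
      push_cast
      rw [mul_inv]
      ring
    have h5 := h1.mul h2
    rw [mul_one] at h5
    refine h5.congr' ?_
    have h6 : ∀ᶠ n : ℕ in atTop, |s| / R < √(n : ℝ) := hsqrt.eventually_gt_atTop _
    filter_upwards [h6] with n hn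
    rw [Set.indicator_of_mem]
    rw [div_lt_iff₀ hR, mul_comm] at hn
    exact ⟨(abs_lt.1 hn).1, (abs_lt.1 hn).2.le⟩

/-- The local probabilities near the mean are eventually at least a multiple of `1 / √n`. -/
lemma exists_le_coeff_pgf_pow {g : ℕ} (hg : 0 < g) (hdvd : ∀ d, μ {d} ≠ 0 → g ∣ d)
    (hL2 : MemLp (fun x : ℕ => (x : ℝ)) 2 μ) (hmean : ∫ x : ℕ, (x : ℝ) ∂μ = 1)
    (hvar : 0 < variance (fun x : ℕ => (x : ℝ)) μ) {c : ℝ} (hc : 0 < c)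
    (hdecay : ∀ u, |u| ≤ √(variance (fun x : ℕ => (x : ℝ)) μ) * (Real.pi / g) →
      ‖charFun (μ.map (standardized μ)) u‖ ≤ Real.exp (-c * u ^ 2)) :
    ∃ K : ℝ, 0 < K ∧ ∃ N : ℕ, ∀ m ≥ N, g ∣ m →
      K / √(m + 1 : ℕ) ≤ (coeff m (pgf μ ^ (m + 1))).toReal := by
  set σ := √(variance (fun x : ℕ => (x : ℝ)) μ) with hσ
  have hσ0 : 0 < σ := Real.sqrt_pos.2 hvar
  have hg' : (0 : ℝ) < g := by exact_mod_cast hg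
  have hlim := tendsto_integral_charFun_pow (σ := σ) hL2 hmean hvar (by positivity) hc hdecay
  -- Since √(2π) > 1, the rescaled integral eventually exceeds 1 in norm.
  have hev := hlim.norm.eventually (lt_mem_nhds (a := 1) (by
    rw [Complex.norm_real, Real.norm_of_nonneg (by positivity), Real.lt_sqrt (by norm_num)]
    linarith [Real.pi_gt_three]))
  obtain ⟨N, hN⟩ := eventually_atTop.1 hev
  refine ⟨g / (2 * Real.pi * σ), by positivity, N, fun m hm hgm => ?_⟩
  have h1 := hN (m + 1) (by omega)
  set r := √((m + 1 : ℕ) : ℝ) with hr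
  have hr0 : 0 < r := Real.sqrt_pos.2 (by positivity)
  have hinv := integral_charNat_pow hg hdvd (m + 1) hgm
  -- Substitute s = σ √(m + 1) t in the inversion integral.
  have hsub := intervalIntegral.integral_comp_mul_right (a := -(Real.pi / g)) (b := Real.pi / g)
    (c := σ * r) (fun s : ℝ => charFun (μ.map (standardized μ)) (r⁻¹ * s) ^ (m + 1) *
      Complex.exp ((σ * r)⁻¹ * s * Complex.I)) (by positivity)
  have heq : ∀ t : ℝ, charFun (μ.map (standardized μ)) (r⁻¹ * (t * (σ * r))) ^ (m + 1) *
      Complex.exp ((σ * r)⁻¹ * ((t * (σ * r) : ℝ) : ℂ) * Complex.I) =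
      charNat μ t ^ (m + 1) * Complex.exp (-(m * t * Complex.I)) := by
    intro t
    have hσc : (σ : ℂ) ≠ 0 := by exact_mod_cast hσ0.ne'
    have hrc : (r : ℂ) ≠ 0 := by exact_mod_cast hr0.ne'
    rw [charNat_eq μ t hvar, ← hσ, mul_pow, ← Complex.exp_nat_mul, mul_assoc (_ ^ (m + 1)),
      ← Complex.exp_add]
    congr 2
    · congr 1
      field_simp
    · push_cast
      field_simp
      ring
  simp only [heq] at hsub
  rw [hinv, show -(Real.pi / g) * (σ * r) = -(σ * (Real.pi / g) * r) by ring,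
    show Real.pi / g * (σ * r) = σ * (Real.pi / g) * r by ring] at hsub
  have h2 := congrArg norm hsub
  rw [norm_smul, Complex.norm_real, Real.norm_of_nonneg (by positivity),
    Real.norm_of_nonneg (by positivity)] at h2
  have h3 : (σ * r)⁻¹ ≤ 2 * Real.pi / g * (coeff m (pgf μ ^ (m + 1))).toReal := by
    rw [h2]
    exact le_mul_of_one_le_right (by positivity) h1.le
  calc _ = g / (2 * Real.pi) * (σ * r)⁻¹ := by field_simp
    _ ≤ g / (2 * Real.pi) * (2 * Real.pi / g * (coeff m (pgf μ ^ (m + 1))).toReal) := by gcongr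
    _ = _ := by field_simp

lemma coeff_pgf_pow_le_one (j m : ℕ) : coeff j (pgf μ ^ m) ≤ 1 := by
  refine (coeff_le_mass _ j).trans ?_
  rw [mass_pow, mass_pgf, one_pow]

/-- The local probabilities are at most a multiple of those near the mean. -/
lemma exists_coeff_le (hL2 : MemLp (fun x : ℕ => (x : ℝ)) 2 μ)
    (hmean : ∫ x : ℕ, (x : ℝ) ∂μ = 1)
    (hvar : 0 < variance (fun x : ℕ => (x : ℝ)) μ) :
    ∃ C : ℝ≥0, ∀ m, 0 < coeff m (pgf μ ^ (m + 1)) → ∀ d,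
      coeff m (X ^ d * pgf μ ^ m) ≤ C * coeff m (pgf μ ^ (m + 1)) := by
  obtain ⟨g, hg, hdvd, hlt⟩ := exists_span μ (measure_zero_ne_zero hL2 hmean hvar)
    (exists_measure_ne_zero hmean)
  set σ := √(variance (fun x : ℕ => (x : ℝ)) μ) with hσ
  have hσ0 : 0 < σ := Real.sqrt_pos.2 hvar
  have hg' : (0 : ℝ) < g := by exact_mod_cast hg
  have hnorm : ∀ t, ‖charNat μ t‖ = ‖charFun (μ.map (standardized μ)) (σ * t)‖ := fun t => by
    rw [charNat_eq μ t hvar, norm_mul, Complex.norm_exp_ofReal_mul_I, mul_one]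
  obtain ⟨c, hc, hdecay⟩ := exists_charFun_decay μ hL2 hmean hvar (R := σ * (Real.pi / g))
    fun u hu hu0 => by
      have := hlt (u / σ) (by rwa [abs_div, abs_of_pos hσ0, div_le_iff₀' hσ0])
        (div_ne_zero hu0 hσ0.ne')
      rwa [hnorm, mul_div_cancel₀ _ hσ0.ne'] at this
  obtain ⟨K, hK, hupper⟩ := exists_coeff_pgf_pow_le hg hdvd (c := c * σ ^ 2) (by positivity)
    fun t ht => by
      rw [hnorm]
      refine (hdecay _ (by rw [abs_mul, abs_of_pos hσ0]; gcongr)).trans_eq ?_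
      congr 1
      ring
  obtain ⟨K', hK', N, hlower⟩ := exists_le_coeff_pgf_pow hg hdvd hL2 hmean hvar hc hdecay
  have hle1 : ∀ m d, coeff m (X ^ d * pgf μ ^ m) ≤ 1 := fun m d => by
    rw [coeff_X_pow_mul']
    split_ifs
    · exact coeff_pgf_pow_le_one _ _
    · exact zero_le
  -- C₁ covers the finitely many m ≤ N, where the left side is at most 1; vanishing coefficients add
  -- 0⁻¹ = 0. The range N + 1 also ensures m ≥ 1 in the other case.
  set C₁ : ℝ≥0 := ∑ m ∈ Finset.range (N + 1), ((coeff m (pgf μ ^ (m + 1))).toNNReal)⁻¹ with hC₁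
  -- The 2 comes from √(m + 1) ≤ 2 √m.
  set C₂ : ℝ≥0 := (2 * K / K').toNNReal with hC₂
  refine ⟨C₁ + C₂, fun m hpos d => ?_⟩
  have hfin : coeff m (pgf μ ^ (m + 1)) ≠ ⊤ :=
    ne_top_of_le_ne_top ENNReal.one_ne_top (coeff_pgf_pow_le_one _ _)
  rcases lt_or_ge m (N + 1) with hm | hm
  · refine (hle1 m d).trans ?_
    have h1 : ((coeff m (pgf μ ^ (m + 1))).toNNReal)⁻¹ ≤ C₁ + C₂ :=
      (Finset.single_le_sum (f := fun m => ((coeff m (pgf μ ^ (m + 1))).toNNReal)⁻¹)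
        (fun _ _ => zero_le) (Finset.mem_range.2 hm)).trans le_self_add
    lift coeff m (pgf μ ^ (m + 1)) to ℝ≥0 using hfin with a ha
    have ha0 : a ≠ 0 := by
      rintro rfl
      simp at hpos
    rw [ENNReal.toNNReal_coe] at h1
    have h2 := mul_le_mul_left h1 a
    rw [inv_mul_cancel₀ ha0] at h2
    exact_mod_cast h2
  -- Positivity of the coefficient puts m in the lattice, as the lower bound requires.
  · have hgm : g ∣ m := dvd_of_coeff_pgf_pow μ hdvd _ _ hpos.ne'
    have hlow := hlower m (by omega) hgm
    have hm0 : 0 < m := by omega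
    have hup : coeff m (X ^ d * pgf μ ^ m) ≤ ENNReal.ofReal (K / √m) := by
      rw [coeff_X_pow_mul']
      split_ifs
      · refine (ENNReal.le_ofReal_iff_toReal_le (ne_top_of_le_ne_top ENNReal.one_ne_top
          (coeff_pgf_pow_le_one _ _)) (by positivity)).2 (hupper m hm0 _)
      · exact zero_le
    refine hup.trans ?_
    have hm1 : (1 : ℝ) ≤ m := by exact_mod_cast hm0
    have hs : √((m + 1 : ℕ) : ℝ) ≤ 2 * √m := by
      rw [Real.sqrt_le_iff]
      refine ⟨by positivity, ?_⟩
      rw [mul_pow, Real.sq_sqrt (by positivity)]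
      push_cast
      linarith
    have hmain : K / √m ≤ 2 * K / K' * (coeff m (pgf μ ^ (m + 1))).toReal := by
      have hsm : 0 < √(m : ℝ) := Real.sqrt_pos.2 (by linarith)
      have hsm1 : 0 < √((m + 1 : ℕ) : ℝ) := Real.sqrt_pos.2 (by positivity)
      calc K / √m ≤ K / (√((m + 1 : ℕ) : ℝ) / 2) := by
            gcongr
            linarith
        _ = 2 * K / K' * (K' / √((m + 1 : ℕ) : ℝ)) := by field_simp
        _ ≤ _ := by gcongr
    calc ENNReal.ofReal (K / √m) ≤
          ENNReal.ofReal (2 * K / K' * (coeff m (pgf μ ^ (m + 1))).toReal) :=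
            ENNReal.ofReal_le_ofReal hmain
      _ = C₂ * coeff m (pgf μ ^ (m + 1)) := by
            rw [ENNReal.ofReal_mul (by positivity), ENNReal.ofReal_toReal hfin]
            rfl
      _ ≤ _ := by
            gcongr
            exact le_add_self

end LocalLimit

end GW

theorem theorem1p1 (μ : Measure ℕ) [IsProbabilityMeasure μ]
    (hL2 : MemLp (fun x : ℕ => (x : ℝ)) 2 μ)
    (hmean : ∫ x : ℕ, (x : ℝ) ∂μ = 1)
    (hvar : 0 < variance (fun x : ℕ => (x : ℝ)) μ) :
    ∃ C : ℝ≥0, 0 < C ∧ ∀ n k : ℕ, 1 ≤ n → 1 ≤ k → 0 < GW.law μ (GW.sizeEvent n) →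
      GW.expectedPairs μ n k ≤ (C : ℝ≥0∞) * (n : ℝ≥0∞) * (k : ℝ≥0∞) := by
  obtain ⟨C, hC⟩ := GW.exists_coeff_le hL2 hmean hvar
  lift ∑' e, μ {e} * (e.choose 2 : ℝ≥0∞) to ℝ≥0 using GW.tsum_choose_two_ne_top μ hL2 with V hV
  refine ⟨1 + C * V, by positivity, fun n k hn hk hpos => ?_⟩
  obtain ⟨m, rfl⟩ : ∃ m, n = m + 1 := ⟨n - 1, by omega⟩
  refine (GW.expectedPairs_le μ C hk (hC m ?_)).trans_eq ?_
  -- The coefficient is n times the probability of size n, so it is positive exactly when the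
  -- conditioned tree exists.
  · rw [GW.pgf, ← GW.succ_mul_coeff_treeGF, ← GW.law_sizeEvent]
    exact ENNReal.mul_pos (by simp) hpos.ne'
  · rw [← hV]
    push_cast
    rfl
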